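/- All games are short games under normal play (a player who cannot move loses): a game $G=\{G^{\mathcal L}\mid G^{\mathcal R}\}$ is given recursively by its finite sets of Left options $G^L$ and Right options $G^R$. Sums and negatives are defined by $G+H=\{G^L+H,\,G+H^L\mid G^R+H,\,G+H^R\}$ and $-G=\{-G^R\mid -G^L\}$, and $G=H$ means that $G+X$ and $H+X$ have the same outcome (Left win, Right win, next-player win or previous-player win) for every short game $X$. A number is a game equal to a dyadic rational, where integers are the games $0=\{\,\mid\,\}$, $n+1=\{n\mid\,\}$, $-(n+1)=\{\,\mid -n\}$ and $\frac{a}{2^{k}}=\{\frac{a-1}{2^{k}}\mid\frac{a+1}{2^{k}}\}$ for $a$ odd, $k\ge 1$. The Left and Right stops are defined by $LS(G)=RS(G)=x$ if $G$ equals the number $x$, and otherwise $LS(G)=\max_{G^L}RS(G^L)$, $RS(G)=\min_{G^R}LS(G^R)$. Put $\ell(G)=LS(G)-RS(G)$, the length of the confusion interval of $G$. Games $G$ and $H$ are infinitesimally close if $LS(G-H)=RS(G-H)=0$. For a dyadic rational $t\ge -1$, the game $G_t$ ($G$ cooled by $t$) is defined recursively as follows. Let $\tilde G_t=\{(G^L)_t-t\mid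 (G^R)_t+t\}$. If $G$ equals an integer $n$, then $G_t=n$. If $G$ does not equal an integer and $\tilde G_s$ is infinitesimally close to a number for some dyadic $s$ with $-1\le s<t$, then $G_t=x$, where $x$ is the number to which $\tilde G_s$ is infinitesimally close for the smallest such $s$. Otherwise $G_t=\tilde G_t$. The temperature $t(G)$ is the smallest dyadic $t\ge -1$ such that $G_t$ is infinitesimally close to a number. The boiling point of a class $S$ of short games is $BP(S)=\sup_{G\in S}t(G)$, taken in the extended reals (so $BP(\emptyset)=-\infty$). **Theorem.** Let $S$ be a class of short games and let $J,K\ge 0$ be real numbers. Suppose that every $G\in S$ satisfies $\ell(G)\le K$, and that every Left option $G^L$ and every Right option $G^R$ of every $G\in S$ satisfies $\ell(G^L)\le J$ and $\ell(G^R)\le J$. Then $$BP(S)\le \frac K2+J.$$ -/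

import Mathlib

/-- A short game (a position of a finite, loop-free two-player game): a position is given by its
finitely many Left options and its finitely many Right options. -/
inductive ShortGame : Type
  | mk (m n : ℕ) (left : Fin m → ShortGame) (right : Fin n → ShortGame) : ShortGame

namespace ShortGame

/-- `H` is a Left option `G^L` of `G`. -/
def IsLeftOption (H : ShortGame) : ShortGame → Prop
  | mk _ _ L _ => ∃ i, L i = H

/-- `H` is a Right option `G^R` of `G`. -/
def IsRightOption (H : ShortGame) : ShortGame → Prop
  | mk _ _ _ R => ∃ j, R j = H

/-! ### Outcomes under normal play -/

mutual

/-- Left, moving first, can force a win: she has a move after which Right, who is then to move,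
cannot force a win. A player who cannot move loses. -/
def LeftWinsFirst : ShortGame → Prop
  | mk m _ L _ => ∃ i : Fin m, ¬ RightWinsFirst (L i)
termination_by structural G => G

/-- Right, moving first, can force a win. -/
def RightWinsFirst : ShortGame → Prop
  | mk _ n _ R => ∃ j : Fin n, ¬ LeftWinsFirst (R j)
termination_by structural G => G

end

/-- The four outcome classes: a win for the next player, for the previous player, for Left,
for Right. -/
inductive Outcome : Type
  | N | P | L | R

open Classical in
/-- The outcome of a game. -/
noncomputable def outcome (G : ShortGame) : Outcome :=
  if LeftWinsFirst G then
    if RightWinsFirst G then Outcome.N else Outcome.L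
  else
    if RightWinsFirst G then Outcome.R else Outcome.P

/-! ### Sum, negative, equality -/

/-- The disjunctive sum `{G^L + H, G + H^L | G^R + H, G + H^R}`, by recursion on `G` and then
on `H`; see `mk_add_mk` for the unfolded form. -/
noncomputable def add (G : ShortGame) : ShortGame → ShortGame :=
  ShortGame.rec (motive := fun _ => ShortGame → ShortGame)
    (fun m n _ _ addL addR H =>
      ShortGame.rec (motive := fun _ => ShortGame)
        (fun m' n' L' R' addL' addR' =>
          mk (m + m') (n + n')
            (Fin.append (fun i => addL i (mk m' n' L' R')) addL')
            (Fin.append (fun j => addR j (mk m' n' L' R')) addR'))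
        H)
    G

noncomputable instance : Add ShortGame := ⟨add⟩

theorem mk_add_mk (m n m' n' : ℕ) (L : Fin m → ShortGame) (R : Fin n → ShortGame)
    (L' : Fin m' → ShortGame) (R' : Fin n' → ShortGame) :
    mk m n L R + mk m' n' L' R' =
      mk (m + m') (n + n')
        (Fin.append (fun i => L i + mk m' n' L' R') (fun i => mk m n L R + L' i))
        (Fin.append (fun j => R j + mk m' n' L' R') (fun j => mk m n L R + R' j)) :=
  rfl

/-- The negative `-G = {-G^R | -G^L}`. -/
def neg : ShortGame → ShortGame
  | mk m n L R => mk n m (fun j => neg (R j)) (fun i => neg (L i))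

instance : Neg ShortGame := ⟨neg⟩

noncomputable instance : Sub ShortGame := ⟨fun G H => G + -H⟩

/-- Equality of game values, `G = H`: the games `G + X` and `H + X` have the same outcome for all
short games `X`. -/
def Equal (G H : ShortGame) : Prop :=
  ∀ X : ShortGame, outcome (G + X) = outcome (H + X)

/-! ### Numbers -/

/-- The games `0 = {|}` and `n + 1 = {n |}`. -/
def ofNat : ℕ → ShortGame
  | 0 => mk 0 0 Fin.elim0 Fin.elim0
  | n + 1 => mk 1 0 (fun _ => ofNat n) Fin.elim0

/-- The integers as games; `-(n + 1) = {| -n}`. -/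
def ofInt : ℤ → ShortGame
  | Int.ofNat n => ofNat n
  | Int.negSucc n => -(ofNat (n + 1))

/-- The canonical game with value `a / 2 ^ k`: an integer if `k = 0`, and
`a / 2 ^ (k + 1) = {(a - 1) / 2 ^ (k + 1) | (a + 1) / 2 ^ (k + 1)}` for odd `a`. -/
def ofDyadic : ℕ → ℤ → ShortGame
  | 0, a => ofInt a
  | k + 1, a =>
    if a % 2 = 0 then ofDyadic k (a / 2)
    else mk 1 1 (fun _ => ofDyadic k ((a - 1) / 2)) (fun _ => ofDyadic k ((a + 1) / 2))

/-- The dyadic rationals, as a subset of `ℚ`. -/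
def IsDyadic (x : ℚ) : Prop := ∃ k : ℕ, x.den = 2 ^ k

/-- The canonical game with value the dyadic rational `x` (only used for dyadic `x`). -/
def number (x : ℚ) : ShortGame := ofDyadic (Nat.log 2 x.den) x.num

/-- `G = x` for the (dyadic rational) number `x`. -/
def EqNumber (G : ShortGame) (x : ℚ) : Prop := IsDyadic x ∧ Equal G (number x)

/-! ### Stops and confusion intervals -/

open Classical in
mutual

/-- The Left stop: `x` if `G` equals the number `x`, and otherwise the largest Right stop of a Left
option (a game without Left options equals an integer, so this is a maximum over a nonempty finite
set). -/
noncomputable def leftStop : ShortGame → ℝ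
  | mk m n L R =>
    if h : ∃ x : ℚ, EqNumber (mk m n L R) x then ((h.choose : ℚ) : ℝ)
    else ⨆ i : Fin m, rightStop (L i)
termination_by structural G => G

/-- The Right stop: `x` if `G` equals the number `x`, and otherwise the smallest Left stop of a
Right option. -/
noncomputable def rightStop : ShortGame → ℝ
  | mk m n L R =>
    if h : ∃ x : ℚ, EqNumber (mk m n L R) x then ((h.choose : ℚ) : ℝ)
    else ⨅ j : Fin n, leftStop (R j)
termination_by structural G => G

end

/-- The length `ℓ(G) = LS(G) - RS(G)` of the confusion interval of `G`. -/
noncomputable def confusionLength (G : ShortGame) : ℝ := leftStop G - rightStop G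

/-- `G` and `H` are infinitesimally close. -/
def InfClose (G H : ShortGame) : Prop := leftStop (G - H) = 0 ∧ rightStop (G - H) = 0

/-- `G` is infinitesimally close to the (dyadic rational) number `x`. -/
def InfCloseNumber (G : ShortGame) (x : ℚ) : Prop := IsDyadic x ∧ InfClose G (number x)

/-! ### Cooling, temperature, boiling point -/

/-- For a family `F` of games, indexed by dyadic `t ≥ -1`, the set of indices `t` for which `F t` is
infinitesimally close to a number. -/
def closeSet (F : ℚ → ShortGame) : Set ℚ :=
  {t | IsDyadic t ∧ -1 ≤ t ∧ ∃ x : ℚ, InfCloseNumber (F t) x}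

open Classical in
/-- One step of the recursive definition of `G_t`, where `F t` stands for
`{(G^L)_t - t | (G^R)_t + t}`: the result is
* the integer `a`, if `G` equals `a`;
* the number `x`, if `G` does not equal an integer, some `s < t` is smallest such that `F s` is
  infinitesimally close to a number, and `x` is this number;
* `F t` otherwise. -/
noncomputable def coolStep (G : ShortGame) (F : ℚ → ShortGame) (t : ℚ) : ShortGame :=
  if h : ∃ a : ℤ, Equal G (ofInt a) then ofInt h.choose
  else if h : ∃ x : ℚ, ∃ s : ℚ, s < t ∧ IsLeast (closeSet F) s ∧ InfCloseNumber (F s) x then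
    number h.choose
  else F t

/-- `G` cooled by `t`, denoted `G_t`, for a dyadic rational `t ≥ -1`. -/
noncomputable def cool : ShortGame → ℚ → ShortGame
  | mk m n L R =>
    coolStep (mk m n L R) fun t =>
      mk m n (fun i => cool (L i) t - number t) (fun j => cool (R j) t + number t)

/-- The temperature of `G`: the smallest `t ≥ -1` such that `G_t` is infinitesimally close to a
number. -/
noncomputable def temperature (G : ShortGame) : ℝ :=
  sInf ((fun t : ℚ => (t : ℝ)) '' closeSet (cool G))

/-- The boiling point of a class of games: the supremum of the temperatures of its members,
in the extended reals. -/
noncomputable def boilingPoint (S : Set ShortGame) : EReal :=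
  ⨆ G ∈ S, ((temperature G : ℝ) : EReal)

end ShortGame

namespace ShortGame

open Filter Topology

-- Let `G` in `S` be a non-integer and let `t ≥ K/2 + J` be dyadic. For a Left option `X` of `G`,
-- `RS(X_t) ≤ LS(X_t) ≤ LS(X) ≤ RS(X) + J ≤ LS(G) + J`, because cooling by `t ≥ 0` never raises a
-- Left stop. After the tax `t`, the best Left move in `G̃_t` therefore leads to at most `LS(G) + J
-- - t`; symmetrically, the best Right move leads to at least `RS(G) - J + t`. Since `LS(G) - RS(G)
-- + 2J ≤ K + 2J ≤ 2t`, the first value does not exceed the second: the two scaffolds have met by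
-- `t`, so `G_t` is infinitesimally close to a number and `t(G) ≤ t` (`mem_closeSet_cool`).
--
-- The rest is the thermography behind this argument. Game values form an ordered group containing
-- the dyadic numbers, and the stops of `G` are the ends of the cut that `G` makes in them
-- (`stops_cut`). Stops therefore translate with numbers, and closeness to a number becomes an
-- inequality between scaffolds (`exists_infCloseNumber_iff`).
--
-- The definition of `G_t` refers to a smallest dyadic `s` at which the scaffolds have met, and that
-- minimum must be shown to exist. The scaffolds are monotone and Lipschitz, and just left of any
-- point they are affine with dyadic constant term and slope `0` or `±1`; two such walls meet at a
-- dyadic point (`Wall.exists_isLeast`). By induction on options, the stops of `G_t` are the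
-- scaffolds up to `s` and constant from there on (`stops_cool_cases`, `wall_stops`).
--
-- Finally `LS(G_0) = LS(G)` is needed. It is not immediate: cooling starts at `-1` and acts on the
-- form of `G`, so a game equal to a fraction must be shown to be frozen at the right number by `t =
-- 0`. This follows from bounds on the stops at the temperatures `-1 / 2 ^ k` (`gridBounds`,
-- `stops_cool_zero`).

theorem option_induction {P : ShortGame → Prop}
    (h : ∀ G, (∀ H, IsLeftOption H G → P H) → (∀ H, IsRightOption H G → P H) → P G)
    (G : ShortGame) : P G := by
  induction G with
  | mk m n L R ihL ihR =>
    refine h _ ?_ ?_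
    · rintro _ ⟨i, rfl⟩
      exact ihL i
    · rintro _ ⟨j, rfl⟩
      exact ihR j

/-! ### Options of negatives and sums -/

instance : Zero ShortGame := ⟨ofNat 0⟩

theorem not_isLeftOption_zero (X : ShortGame) : ¬ IsLeftOption X 0 := fun h => Fin.elim0 h.choose

theorem not_isRightOption_zero (X : ShortGame) : ¬ IsRightOption X 0 := fun h => Fin.elim0 h.choose

theorem isLeftOption_neg {X G : ShortGame} :
    IsLeftOption X (-G) ↔ ∃ Y, IsRightOption Y G ∧ X = -Y := by
  cases G with
  | mk m n L R =>
    constructor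
    · rintro ⟨j, rfl⟩
      exact ⟨R j, ⟨j, rfl⟩, rfl⟩
    · rintro ⟨_, ⟨j, rfl⟩, rfl⟩
      exact ⟨j, rfl⟩

theorem isRightOption_neg {X G : ShortGame} :
    IsRightOption X (-G) ↔ ∃ Y, IsLeftOption Y G ∧ X = -Y := by
  cases G with
  | mk m n L R =>
    constructor
    · rintro ⟨j, rfl⟩
      exact ⟨L j, ⟨j, rfl⟩, rfl⟩
    · rintro ⟨_, ⟨j, rfl⟩, rfl⟩
      exact ⟨j, rfl⟩

theorem isLeftOption_add {X G H : ShortGame} :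
    IsLeftOption X (G + H) ↔
      (∃ Y, IsLeftOption Y G ∧ X = Y + H) ∨ ∃ Y, IsLeftOption Y H ∧ X = G + Y := by
  cases G with
  | mk m n L R =>
    cases H with
    | mk m' n' L' R' =>
      rw [mk_add_mk]
      constructor
      · rintro ⟨i, hi⟩
        induction i using Fin.addCases with
        | left i => exact Or.inl ⟨L i, ⟨i, rfl⟩, by rw [← hi, Fin.append_left]⟩
        | right i => exact Or.inr ⟨L' i, ⟨i, rfl⟩, by rw [← hi, Fin.append_right]⟩
      · rintro (⟨_, ⟨i, rfl⟩, rfl⟩ | ⟨_, ⟨i, rfl⟩, rfl⟩)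
        · exact ⟨Fin.castAdd m' i, Fin.append_left _ _ i⟩
        · exact ⟨Fin.natAdd m i, Fin.append_right _ _ i⟩

theorem isRightOption_add {X G H : ShortGame} :
    IsRightOption X (G + H) ↔
      (∃ Y, IsRightOption Y G ∧ X = Y + H) ∨ ∃ Y, IsRightOption Y H ∧ X = G + Y := by
  cases G with
  | mk m n L R =>
    cases H with
    | mk m' n' L' R' =>
      rw [mk_add_mk]
      constructor
      · rintro ⟨i, hi⟩
        induction i using Fin.addCases with
        | left i => exact Or.inl ⟨R i, ⟨i, rfl⟩, by rw [← hi, Fin.append_left]⟩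
        | right i => exact Or.inr ⟨R' i, ⟨i, rfl⟩, by rw [← hi, Fin.append_right]⟩
      · rintro (⟨_, ⟨i, rfl⟩, rfl⟩ | ⟨_, ⟨i, rfl⟩, rfl⟩)
        · exact ⟨Fin.castAdd n' i, Fin.append_left _ _ i⟩
        · exact ⟨Fin.natAdd n i, Fin.append_right _ _ i⟩

/-! ### The order -/

/-- The pair of relations `G ≤ H` and `G ⧏ H` (that is, `¬ H ≤ G`), defined simultaneously. -/
noncomputable def leLf (G : ShortGame) : ShortGame → Prop × Prop :=
  ShortGame.rec (motive := fun _ => ShortGame → Prop × Prop)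
    (fun _ _ _ _ ihL ihR H =>
      ShortGame.rec (motive := fun _ => Prop × Prop)
        (fun m' n' L' R' ihL' ihR' =>
          ((∀ i, (ihL i (mk m' n' L' R')).2) ∧ ∀ j, (ihR' j).2,
            (∃ i, (ihL' i).1) ∨ ∃ j, (ihR j (mk m' n' L' R')).1))
        H)
    G

noncomputable instance : LE ShortGame := ⟨fun G H => (leLf G H).1⟩

theorem leLf_fst_iff {G H : ShortGame} : (leLf G H).1 ↔
    (∀ X, IsLeftOption X G → (leLf X H).2) ∧ ∀ X, IsRightOption X H → (leLf G X).2 := by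
  cases G with
  | mk m n L R =>
    cases H with
    | mk m' n' L' R' =>
      constructor
      · rintro ⟨h₁, h₂⟩
        exact ⟨by rintro _ ⟨i, rfl⟩; exact h₁ i, by rintro _ ⟨i, rfl⟩; exact h₂ i⟩
      · rintro ⟨h₁, h₂⟩
        exact ⟨fun i => h₁ _ ⟨i, rfl⟩, fun i => h₂ _ ⟨i, rfl⟩⟩

theorem leLf_snd_iff {G H : ShortGame} : (leLf G H).2 ↔
    (∃ X, IsLeftOption X H ∧ (leLf G X).1) ∨ ∃ X, IsRightOption X G ∧ (leLf X H).1 := by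
  cases G with
  | mk m n L R =>
    cases H with
    | mk m' n' L' R' =>
      constructor
      · rintro (⟨i, hi⟩ | ⟨i, hi⟩)
        · exact Or.inl ⟨_, ⟨i, rfl⟩, hi⟩
        · exact Or.inr ⟨_, ⟨i, rfl⟩, hi⟩
      · rintro (⟨_, ⟨i, rfl⟩, hi⟩ | ⟨_, ⟨i, rfl⟩, hi⟩)
        · exact Or.inl ⟨i, hi⟩
        · exact Or.inr ⟨i, hi⟩

/-- Unfolding one relation produces the other with its arguments exchanged, so the induction has to
carry both orders of `G` and `H`. -/
theorem leLf_snd_iff_not (G H : ShortGame) :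
    ((leLf G H).2 ↔ ¬ (leLf H G).1) ∧ ((leLf H G).2 ↔ ¬ (leLf G H).1) := by
  induction G using option_induction generalizing H with
  | _ G ihL ihR =>
    induction H using option_induction with
    | _ H ihL' ihR' =>
      constructor
      · rw [leLf_snd_iff, leLf_fst_iff, not_and_or]
        push Not
        refine or_congr (exists_congr fun X => and_congr_right fun hX => ?_)
          (exists_congr fun X => and_congr_right fun hX => ?_)
        · rw [(ihL' X hX).2, not_not]
        · rw [(ihR X hX H).2, not_not]
      · rw [leLf_snd_iff, leLf_fst_iff, not_and_or]
        push Not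
        refine or_congr (exists_congr fun X => and_congr_right fun hX => ?_)
          (exists_congr fun X => and_congr_right fun hX => ?_)
        · rw [(ihL X hX H).1, not_not]
        · rw [(ihR' X hX).1, not_not]

theorem le_iff_options {G H : ShortGame} : G ≤ H ↔
    (∀ X, IsLeftOption X G → ¬ H ≤ X) ∧ ∀ X, IsRightOption X H → ¬ X ≤ G := by
  refine leLf_fst_iff.trans (and_congr ?_ ?_)
  · exact forall_congr' fun X => imp_congr_right fun _ => (leLf_snd_iff_not X H).1
  · exact forall_congr' fun X => imp_congr_right fun _ => (leLf_snd_iff_not G X).1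

theorem not_le_iff_options {G H : ShortGame} : ¬ G ≤ H ↔
    (∃ X, IsLeftOption X G ∧ H ≤ X) ∨ ∃ X, IsRightOption X H ∧ X ≤ G := by
  rw [le_iff_options, not_and_or]
  push Not
  rfl

theorem le_self (G : ShortGame) : G ≤ G := by
  induction G using option_induction with
  | _ G ihL ihR =>
    exact le_iff_options.2 ⟨fun X hX h => (le_iff_options.1 h).1 X hX (ihL X hX),
      fun X hX h => (le_iff_options.1 h).2 X hX (ihR X hX)⟩

/-- If `G ≤ H ≤ K` but `K ≤ X` for a Left option `X` of `G`, then `H ≤ K ≤ X` should give `H ≤ X`: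
an instance of transitivity for the rotated triple. Carrying all three rotations closes the
induction. -/
theorem le_trans_rotations (G H K : ShortGame) :
    (G ≤ H → H ≤ K → G ≤ K) ∧ (H ≤ K → K ≤ G → H ≤ G) ∧ (K ≤ G → G ≤ H → K ≤ H) := by
  induction G using option_induction generalizing H K with
  | _ G ihL ihR =>
    induction H using option_induction generalizing K with
    | _ H ihL' ihR' =>
      induction K using option_induction with
      | _ K ihL'' ihR'' =>
        refine ⟨fun h₁ h₂ => ?_, fun h₁ h₂ => ?_, fun h₁ h₂ => ?_⟩
        · exact le_iff_options.2
            ⟨fun X hX h => (le_iff_options.1 h₁).1 X hX ((ihL X hX H K).2.1 h₂ h),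
              fun X hX h => (le_iff_options.1 h₂).2 X hX ((ihR'' X hX).2.2 h h₁)⟩
        · exact le_iff_options.2
            ⟨fun X hX h => (le_iff_options.1 h₁).1 X hX ((ihL' X hX K).2.2 h₂ h),
              fun X hX h => (le_iff_options.1 h₂).2 X hX ((ihR X hX H K).1 h h₁)⟩
        · exact le_iff_options.2
            ⟨fun X hX h => (le_iff_options.1 h₁).1 X hX ((ihL'' X hX).1 h₂ h),
              fun X hX h => (le_iff_options.1 h₂).2 X hX ((ihR' X hX K).2.1 h h₁)⟩

noncomputable instance : Preorder ShortGame where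
  le_refl := le_self
  le_trans G H K := (le_trans_rotations G H K).1

theorem not_le_left {X G : ShortGame} (h : IsLeftOption X G) : ¬ G ≤ X :=
  (le_iff_options.1 (le_refl G)).1 X h

theorem not_le_right {X G : ShortGame} (h : IsRightOption X G) : ¬ X ≤ G :=
  (le_iff_options.1 (le_refl G)).2 X h

theorem le_of_options {G H : ShortGame}
    (h₁ : ∀ X, IsLeftOption X G → ∃ Y, IsLeftOption Y H ∧ X ≤ Y)
    (h₂ : ∀ Y, IsRightOption Y H → ∃ X, IsRightOption X G ∧ X ≤ Y) : G ≤ H := by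
  refine le_iff_options.2 ⟨fun X hX h => ?_, fun Y hY h => ?_⟩
  · obtain ⟨Y, hY, hXY⟩ := h₁ X hX
    exact not_le_left hY (h.trans hXY)
  · obtain ⟨X, hX, hXY⟩ := h₂ Y hY
    exact not_le_right hX (hXY.trans h)

/-! ### Sums and negatives respect the order -/

theorem neg_le_neg_iff_aux (G H : ShortGame) : (-H ≤ -G ↔ G ≤ H) ∧ (-G ≤ -H ↔ H ≤ G) := by
  induction G using option_induction generalizing H with
  | _ G ihL ihR =>
    induction H using option_induction with
    | _ H ihL' ihR' =>
      rw [le_iff_options (G := -H) (H := -G), le_iff_options (G := G) (H := H),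
        le_iff_options (G := -G) (H := -H), le_iff_options (G := H) (H := G)]
      simp only [isLeftOption_neg, isRightOption_neg, forall_exists_index, and_imp]
      refine ⟨⟨fun h => ?_, fun h => ?_⟩, ⟨fun h => ?_, fun h => ?_⟩⟩
      · exact ⟨fun X hX h' => h.2 _ X hX rfl ((ihL X hX H).2.2 h'),
          fun X hX h' => h.1 _ X hX rfl ((ihR' X hX).2.2 h')⟩
      · constructor
        · rintro _ X hX rfl h'
          exact h.2 X hX ((ihR' X hX).2.1 h')
        · rintro _ X hX rfl h'
          exact h.1 X hX ((ihL X hX H).2.1 h')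
      · exact ⟨fun X hX h' => h.2 _ X hX rfl ((ihL' X hX).1.2 h'),
          fun X hX h' => h.1 _ X hX rfl ((ihR X hX H).1.2 h')⟩
      · constructor
        · rintro _ X hX rfl h'
          exact h.2 X hX ((ihR X hX H).1.1 h')
        · rintro _ X hX rfl h'
          exact h.1 X hX ((ihL' X hX).1.1 h')

theorem neg_le_neg_of_le {G H : ShortGame} (h : G ≤ H) : -H ≤ -G := (neg_le_neg_iff_aux G H).1.2 h

theorem add_comm_le (G H : ShortGame) : G + H ≤ H + G := by
  induction G using option_induction generalizing H with
  | _ G ihL ihR =>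
    induction H using option_induction with
    | _ H ihL' ihR' =>
      refine le_of_options (fun X hX => ?_) (fun X hX => ?_)
      · rcases isLeftOption_add.1 hX with ⟨Y, hY, rfl⟩ | ⟨Y, hY, rfl⟩
        · exact ⟨_, isLeftOption_add.2 (Or.inr ⟨Y, hY, rfl⟩), ihL Y hY H⟩
        · exact ⟨_, isLeftOption_add.2 (Or.inl ⟨Y, hY, rfl⟩), ihL' Y hY⟩
      · rcases isRightOption_add.1 hX with ⟨Y, hY, rfl⟩ | ⟨Y, hY, rfl⟩
        · exact ⟨_, isRightOption_add.2 (Or.inr ⟨Y, hY, rfl⟩), ihR' Y hY⟩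
        · exact ⟨_, isRightOption_add.2 (Or.inl ⟨Y, hY, rfl⟩), ihR Y hY H⟩

theorem add_assoc_le (G H K : ShortGame) : G + H + K ≤ G + (H + K) ∧ G + (H + K) ≤ G + H + K := by
  induction G using option_induction generalizing H K with
  | _ G ihL ihR =>
    induction H using option_induction generalizing K with
    | _ H ihL' ihR' =>
      induction K using option_induction with
      | _ K ihL'' ihR'' =>
        constructor
        · refine le_of_options (fun X hX => ?_) (fun X hX => ?_)
          · simp only [isLeftOption_add] at hX ⊢
            rcases hX with ⟨_, ⟨Y, hY, rfl⟩ | ⟨Y, hY, rfl⟩, rfl⟩ | ⟨Y, hY, rfl⟩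
            · exact ⟨_, Or.inl ⟨Y, hY, rfl⟩, (ihL Y hY H K).1⟩
            · exact ⟨_, Or.inr ⟨_, Or.inl ⟨Y, hY, rfl⟩, rfl⟩, (ihL' Y hY K).1⟩
            · exact ⟨_, Or.inr ⟨_, Or.inr ⟨Y, hY, rfl⟩, rfl⟩, (ihL'' Y hY).1⟩
          · simp only [isRightOption_add] at hX ⊢
            rcases hX with ⟨Y, hY, rfl⟩ | ⟨_, ⟨Y, hY, rfl⟩ | ⟨Y, hY, rfl⟩, rfl⟩
            · exact ⟨_, Or.inl ⟨_, Or.inl ⟨Y, hY, rfl⟩, rfl⟩, (ihR Y hY H K).1⟩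
            · exact ⟨_, Or.inl ⟨_, Or.inr ⟨Y, hY, rfl⟩, rfl⟩, (ihR' Y hY K).1⟩
            · exact ⟨_, Or.inr ⟨Y, hY, rfl⟩, (ihR'' Y hY).1⟩
        · refine le_of_options (fun X hX => ?_) (fun X hX => ?_)
          · simp only [isLeftOption_add] at hX ⊢
            rcases hX with ⟨Y, hY, rfl⟩ | ⟨_, ⟨Y, hY, rfl⟩ | ⟨Y, hY, rfl⟩, rfl⟩
            · exact ⟨_, Or.inl ⟨_, Or.inl ⟨Y, hY, rfl⟩, rfl⟩, (ihL Y hY H K).2⟩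
            · exact ⟨_, Or.inl ⟨_, Or.inr ⟨Y, hY, rfl⟩, rfl⟩, (ihL' Y hY K).2⟩
            · exact ⟨_, Or.inr ⟨Y, hY, rfl⟩, (ihL'' Y hY).2⟩
          · simp only [isRightOption_add] at hX ⊢
            rcases hX with ⟨_, ⟨Y, hY, rfl⟩ | ⟨Y, hY, rfl⟩, rfl⟩ | ⟨Y, hY, rfl⟩
            · exact ⟨_, Or.inl ⟨Y, hY, rfl⟩, (ihR Y hY H K).2⟩
            · exact ⟨_, Or.inr ⟨_, Or.inl ⟨Y, hY, rfl⟩, rfl⟩, (ihR' Y hY K).2⟩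
            · exact ⟨_, Or.inr ⟨_, Or.inr ⟨Y, hY, rfl⟩, rfl⟩, (ihR'' Y hY).2⟩

theorem add_zero_le (G : ShortGame) : G + 0 ≤ G ∧ G ≤ G + 0 := by
  induction G using option_induction with
  | _ G ihL ihR =>
    constructor
    · refine le_of_options (fun X hX => ?_) (fun X hX => ?_)
      · rcases isLeftOption_add.1 hX with ⟨Y, hY, rfl⟩ | ⟨Y, hY, rfl⟩
        · exact ⟨Y, hY, (ihL Y hY).1⟩
        · exact absurd hY (not_isLeftOption_zero Y)
      · exact ⟨_, isRightOption_add.2 (Or.inl ⟨X, hX, rfl⟩), (ihR X hX).1⟩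
    · refine le_of_options (fun X hX => ?_) (fun X hX => ?_)
      · exact ⟨_, isLeftOption_add.2 (Or.inl ⟨X, hX, rfl⟩), (ihL X hX).2⟩
      · rcases isRightOption_add.1 hX with ⟨Y, hY, rfl⟩ | ⟨Y, hY, rfl⟩
        · exact ⟨Y, hY, (ihR Y hY).2⟩
        · exact absurd hY (not_isRightOption_zero Y)

theorem add_neg_self_le (G : ShortGame) : G + -G ≤ 0 ∧ 0 ≤ G + -G := by
  induction G using option_induction with
  | _ G ihL ihR =>
    constructor
    · refine le_iff_options.2 ⟨fun X hX h => ?_, fun X hX => absurd hX (not_isRightOption_zero X)⟩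
      rcases isLeftOption_add.1 hX with ⟨Y, hY, rfl⟩ | ⟨_, hY', rfl⟩
      · exact (le_iff_options.1 h).2 (Y + -Y)
          (isRightOption_add.2 (Or.inr ⟨_, isRightOption_neg.2 ⟨Y, hY, rfl⟩, rfl⟩)) (ihL Y hY).1
      · obtain ⟨Y, hY, rfl⟩ := isLeftOption_neg.1 hY'
        exact (le_iff_options.1 h).2 (Y + -Y) (isRightOption_add.2 (Or.inl ⟨Y, hY, rfl⟩))
          (ihR Y hY).1
    · refine le_iff_options.2 ⟨fun X hX => absurd hX (not_isLeftOption_zero X), fun X hX h => ?_⟩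
      rcases isRightOption_add.1 hX with ⟨Y, hY, rfl⟩ | ⟨_, hY', rfl⟩
      · exact (le_iff_options.1 h).1 (Y + -Y)
          (isLeftOption_add.2 (Or.inr ⟨_, isLeftOption_neg.2 ⟨Y, hY, rfl⟩, rfl⟩)) (ihR Y hY).2
      · obtain ⟨Y, hY, rfl⟩ := isRightOption_neg.1 hY'
        exact (le_iff_options.1 h).1 (Y + -Y) (isLeftOption_add.2 (Or.inl ⟨Y, hY, rfl⟩))
          (ihL Y hY).2

/-- The second, strict half handles moves in the first summand, where a comparison of options is
known only in negated form. -/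
theorem add_le_add_right_aux (G H K : ShortGame) :
    ((G ≤ H → G + K ≤ H + K) ∧ (¬ H ≤ G → ¬ H + K ≤ G + K)) := by
  induction G using option_induction generalizing H K with
  | _ G ihL ihR =>
    induction H using option_induction generalizing K with
    | _ H ihL' ihR' =>
      induction K using option_induction with
      | _ K ihL'' ihR'' =>
        constructor
        · intro h
          refine le_iff_options.2 ⟨fun X hX => ?_, fun X hX => ?_⟩
          · rcases isLeftOption_add.1 hX with ⟨Y, hY, rfl⟩ | ⟨Y, hY, rfl⟩
            · exact (ihL Y hY H K).2 ((le_iff_options.1 h).1 Y hY)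
            · exact not_le_iff_options.2 (Or.inl
                ⟨_, isLeftOption_add.2 (Or.inr ⟨Y, hY, rfl⟩), (ihL'' Y hY).1 h⟩)
          · rcases isRightOption_add.1 hX with ⟨Y, hY, rfl⟩ | ⟨Y, hY, rfl⟩
            · exact (ihR' Y hY K).2 ((le_iff_options.1 h).2 Y hY)
            · exact not_le_iff_options.2 (Or.inr
                ⟨_, isRightOption_add.2 (Or.inr ⟨Y, hY, rfl⟩), (ihR'' Y hY).1 h⟩)
        · intro h
          rcases not_le_iff_options.1 h with ⟨Y, hY, h⟩ | ⟨Y, hY, h⟩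
          · exact not_le_iff_options.2 (Or.inl
              ⟨_, isLeftOption_add.2 (Or.inl ⟨Y, hY, rfl⟩), (ihL' Y hY K).1 h⟩)
          · exact not_le_iff_options.2 (Or.inr
              ⟨_, isRightOption_add.2 (Or.inl ⟨Y, hY, rfl⟩), (ihR Y hY H K).1 h⟩)

theorem add_le_add_of_le {G G' H H' : ShortGame} (h : G ≤ G') (h' : H ≤ H') :
    G + H ≤ G' + H' :=
  ((add_le_add_right_aux G G' H).1 h).trans <| (add_comm_le _ _).trans <|
    ((add_le_add_right_aux H H' G').1 h').trans (add_comm_le _ _)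

/-! ### The ordered group of game values -/

/-- Short games up to equality of values. -/
abbrev Value : Type := Antisymmetrization ShortGame (· ≤ ·)

/-- The value of a game. -/
def toValue (G : ShortGame) : Value := toAntisymmetrization (· ≤ ·) G

theorem toValue_le {G H : ShortGame} : toValue G ≤ toValue H ↔ G ≤ H :=
  toAntisymmetrization_le_toAntisymmetrization_iff

theorem toValue_eq {G H : ShortGame} : toValue G = toValue H ↔ G ≤ H ∧ H ≤ G := by
  rw [le_antisymm_iff, toValue_le, toValue_le]

theorem toValue_surjective : Function.Surjective toValue := Quotient.mk_surjective

noncomputable instance : Add Value :=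
  ⟨Quotient.map₂ (· + ·) fun _ _ h _ _ h' =>
    ⟨add_le_add_of_le h.1 h'.1, add_le_add_of_le h.2 h'.2⟩⟩

instance : Neg Value :=
  ⟨Quotient.map (- ·) fun _ _ h => ⟨neg_le_neg_of_le h.2, neg_le_neg_of_le h.1⟩⟩

instance : Zero Value := ⟨toValue 0⟩

theorem toValue_add (G H : ShortGame) : toValue (G + H) = toValue G + toValue H := rfl

theorem toValue_neg (G : ShortGame) : toValue (-G) = -toValue G := rfl

theorem toValue_zero : toValue 0 = 0 := rfl

theorem value_add_comm (a b : Value) : a + b = b + a := by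
  obtain ⟨G, rfl⟩ := toValue_surjective a
  obtain ⟨H, rfl⟩ := toValue_surjective b
  rw [← toValue_add, ← toValue_add]
  exact toValue_eq.2 ⟨add_comm_le G H, add_comm_le H G⟩

theorem value_add_zero (a : Value) : a + 0 = a := by
  obtain ⟨G, rfl⟩ := toValue_surjective a
  rw [← toValue_zero, ← toValue_add]
  exact toValue_eq.2 (add_zero_le G)

theorem value_add_neg (a : Value) : a + -a = 0 := by
  obtain ⟨G, rfl⟩ := toValue_surjective a
  rw [← toValue_zero, ← toValue_neg, ← toValue_add]
  exact toValue_eq.2 (add_neg_self_le G)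

noncomputable instance : AddCommGroup Value where
  add_assoc a b c := by
    obtain ⟨G, rfl⟩ := toValue_surjective a
    obtain ⟨H, rfl⟩ := toValue_surjective b
    obtain ⟨K, rfl⟩ := toValue_surjective c
    simp only [← toValue_add]
    exact toValue_eq.2 (add_assoc_le G H K)
  zero_add a := by rw [value_add_comm, value_add_zero]
  add_zero := value_add_zero
  add_comm := value_add_comm
  neg_add_cancel a := by rw [value_add_comm, value_add_neg]
  nsmul := nsmulRec
  zsmul := zsmulRec

instance : IsOrderedAddMonoid Value where
  add_le_add_left a b h c := by
    obtain ⟨G, rfl⟩ := toValue_surjective a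
    obtain ⟨H, rfl⟩ := toValue_surjective b
    obtain ⟨K, rfl⟩ := toValue_surjective c
    simp only [← toValue_add]
    exact toValue_le.2 (add_le_add_of_le (toValue_le.1 h) le_rfl)

theorem toValue_sub (G H : ShortGame) : toValue (G - H) = toValue G - toValue H :=
  (sub_eq_add_neg (toValue G) (toValue H)).symm

/-! ### Outcomes and equality -/

theorem leftWinsFirst_iff_option {G : ShortGame} :
    LeftWinsFirst G ↔ ∃ X, IsLeftOption X G ∧ ¬ RightWinsFirst X := by
  cases G with
  | mk m n L R =>
    rw [LeftWinsFirst]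
    exact ⟨fun ⟨i, hi⟩ => ⟨_, ⟨i, rfl⟩, hi⟩, by rintro ⟨_, ⟨i, rfl⟩, hi⟩; exact ⟨i, hi⟩⟩

theorem rightWinsFirst_iff_option {G : ShortGame} :
    RightWinsFirst G ↔ ∃ X, IsRightOption X G ∧ ¬ LeftWinsFirst X := by
  cases G with
  | mk m n L R =>
    rw [RightWinsFirst]
    exact ⟨fun ⟨i, hi⟩ => ⟨_, ⟨i, rfl⟩, hi⟩, by rintro ⟨_, ⟨i, rfl⟩, hi⟩; exact ⟨i, hi⟩⟩

/-- A comparison with `0` unfolds to exactly the existence of a winning move, since `0` has no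
options of its own. -/
theorem winsFirst_iff (G : ShortGame) :
    (LeftWinsFirst G ↔ ¬ G ≤ 0) ∧ (RightWinsFirst G ↔ ¬ 0 ≤ G) := by
  induction G using option_induction with
  | _ G ihL ihR =>
    rw [leftWinsFirst_iff_option, rightWinsFirst_iff_option, not_le_iff_options,
      not_le_iff_options]
    constructor
    · constructor
      · rintro ⟨X, hX, h⟩
        exact Or.inl ⟨X, hX, not_not.1 (mt (ihL X hX).2.2 h)⟩
      · rintro (⟨X, hX, h⟩ | ⟨X, hX, h⟩)
        · exact ⟨X, hX, fun h' => (ihL X hX).2.1 h' h⟩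
        · exact absurd hX (not_isRightOption_zero X)
    · constructor
      · rintro ⟨X, hX, h⟩
        exact Or.inr ⟨X, hX, not_not.1 (mt (ihR X hX).1.2 h)⟩
      · rintro (⟨X, hX, h⟩ | ⟨X, hX, h⟩)
        · exact absurd hX (not_isLeftOption_zero X)
        · exact ⟨X, hX, fun h' => (ihR X hX).1.1 h' h⟩

theorem outcome_eq_iff {G H : ShortGame} :
    outcome G = outcome H ↔ (G ≤ 0 ↔ H ≤ 0) ∧ (0 ≤ G ↔ 0 ≤ H) := by
  rw [← not_iff_not (a := G ≤ 0), ← not_iff_not (a := 0 ≤ G), ← (winsFirst_iff G).1,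
    ← (winsFirst_iff H).1, ← (winsFirst_iff G).2, ← (winsFirst_iff H).2]
  unfold outcome
  split_ifs <;> simp_all

theorem equal_iff {G H : ShortGame} : Equal G H ↔ toValue G = toValue H := by
  constructor
  · intro h
    -- The single test summand `-H` suffices: `H - H` has value `0`, so `G - H` compares with `0` as
    -- `0` does.
    have h' := outcome_eq_iff.1 (h (-H))
    simp only [← toValue_le, toValue_add, toValue_neg, toValue_zero] at h'
    simp only [add_neg_cancel, le_refl, iff_true] at h'
    exact sub_eq_zero.1 ((sub_eq_add_neg _ _).trans (le_antisymm h'.1 h'.2))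
  · intro h X
    rw [outcome_eq_iff]
    simp only [← toValue_le, toValue_add, h, and_self]

/-! ### Dyadic rationals -/

/-- `x` is an integral multiple of `1 / 2 ^ k`. -/
def OnGrid (k : ℕ) (x : ℚ) : Prop := ∃ a : ℤ, x = a / 2 ^ k

theorem OnGrid.mono {k l : ℕ} {x : ℚ} (h : OnGrid k x) (hkl : k ≤ l) : OnGrid l x := by
  obtain ⟨a, rfl⟩ := h
  obtain ⟨d, rfl⟩ := Nat.exists_eq_add_of_le hkl
  refine ⟨a * 2 ^ d, ?_⟩
  push_cast
  rw [pow_add, mul_div_mul_right _ _ (by positivity)]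

theorem OnGrid.add {k : ℕ} {x y : ℚ} (hx : OnGrid k x) (hy : OnGrid k y) : OnGrid k (x + y) := by
  obtain ⟨a, rfl⟩ := hx
  obtain ⟨b, rfl⟩ := hy
  exact ⟨a + b, by push_cast; ring⟩

theorem OnGrid.neg {k : ℕ} {x : ℚ} (hx : OnGrid k x) : OnGrid k (-x) := by
  obtain ⟨a, rfl⟩ := hx
  exact ⟨-a, by push_cast; ring⟩

theorem OnGrid.sub {k : ℕ} {x y : ℚ} (hx : OnGrid k x) (hy : OnGrid k y) : OnGrid k (x - y) := by
  rw [sub_eq_add_neg]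
  exact hx.add hy.neg

theorem onGrid_intCast (k : ℕ) (n : ℤ) : OnGrid k n := OnGrid.mono (k := 0) ⟨n, by simp⟩ k.zero_le

theorem onGrid_one_div (k : ℕ) : OnGrid k (1 / 2 ^ k) := ⟨1, by simp⟩

theorem OnGrid.add_le_of_lt {k : ℕ} {x y : ℚ} (hx : OnGrid k x) (hy : OnGrid k y) (h : x < y) :
    x + 1 / 2 ^ k ≤ y := by
  obtain ⟨a, rfl⟩ := hx
  obtain ⟨b, rfl⟩ := hy
  rw [← add_div]
  rw [div_lt_div_iff_of_pos_right (by positivity)] at h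
  rw [div_le_div_iff_of_pos_right (by positivity)]
  exact_mod_cast h

theorem isDyadic_iff {x : ℚ} : IsDyadic x ↔ ∃ k, OnGrid k x := by
  constructor
  · rintro ⟨k, hk⟩
    refine ⟨k, x.num, ?_⟩
    conv_lhs => rw [← Rat.num_div_den x, hk]
    push_cast
    rfl
  · rintro ⟨k, a, rfl⟩
    have h : ((a : ℚ) / 2 ^ k).den ∣ 2 ^ k := by
      have h := Rat.den_dvd a (2 ^ k : ℤ)
      rw [Rat.divInt_eq_div] at h
      push_cast at h
      exact_mod_cast h
    obtain ⟨m, -, hm⟩ := (Nat.dvd_prime_pow Nat.prime_two).1 h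
    exact ⟨m, hm⟩

theorem OnGrid.isDyadic {k : ℕ} {x : ℚ} (h : OnGrid k x) : IsDyadic x := isDyadic_iff.2 ⟨k, h⟩

theorem IsDyadic.exists_common {x y : ℚ} (hx : IsDyadic x) (hy : IsDyadic y) :
    ∃ k, OnGrid k x ∧ OnGrid k y := by
  obtain ⟨k, hk⟩ := isDyadic_iff.1 hx
  obtain ⟨l, hl⟩ := isDyadic_iff.1 hy
  exact ⟨max k l, hk.mono (le_max_left k l), hl.mono (le_max_right k l)⟩

theorem IsDyadic.add {x y : ℚ} (hx : IsDyadic x) (hy : IsDyadic y) : IsDyadic (x + y) :=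
  let ⟨_, h, h'⟩ := hx.exists_common hy
  (h.add h').isDyadic

theorem IsDyadic.sub {x y : ℚ} (hx : IsDyadic x) (hy : IsDyadic y) : IsDyadic (x - y) :=
  let ⟨_, h, h'⟩ := hx.exists_common hy
  (h.sub h').isDyadic

theorem IsDyadic.neg {x : ℚ} (hx : IsDyadic x) : IsDyadic (-x) :=
  let ⟨_, h⟩ := isDyadic_iff.1 hx
  h.neg.isDyadic

theorem isDyadic_intCast (n : ℤ) : IsDyadic n := (onGrid_intCast 0 n).isDyadic

theorem isDyadic_natCast (n : ℕ) : IsDyadic n := isDyadic_intCast n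

theorem isDyadic_zero : IsDyadic 0 := isDyadic_natCast 0

theorem IsDyadic.half {x : ℚ} (hx : IsDyadic x) : IsDyadic (x / 2) := by
  obtain ⟨k, a, rfl⟩ := isDyadic_iff.1 hx
  exact OnGrid.isDyadic (k := k + 1) ⟨a, by rw [pow_succ, div_div]⟩

theorem exists_isDyadic_between {a b : ℝ} (h : a < b) : ∃ x : ℚ, IsDyadic x ∧ a < x ∧ x < b := by
  obtain ⟨k, hk⟩ := exists_nat_gt (1 / (b - a))
  have hpos : (0 : ℝ) < 2 ^ k := by positivity
  have h1 : 1 < (b - a) * 2 ^ k := by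
    have h2 : (k : ℝ) < 2 ^ k := by exact_mod_cast Nat.lt_two_pow_self
    have h3 := (div_lt_iff₀ (sub_pos.2 h)).1 hk
    nlinarith [sub_pos.2 h]
  refine ⟨((⌊a * 2 ^ k⌋ + 1 : ℤ) : ℚ) / 2 ^ k, OnGrid.isDyadic (k := k) ⟨_, rfl⟩, ?_, ?_⟩
  · push_cast
    rw [lt_div_iff₀ hpos]
    exact Int.lt_floor_add_one _
  · push_cast
    rw [div_lt_iff₀ hpos]
    have := Int.floor_le (a * 2 ^ k)
    linarith

theorem IsDyadic.exists_exponent {x : ℚ} (hx : IsDyadic x) :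
    ∃ k, OnGrid k x ∧ ∀ l, OnGrid l x → k ≤ l := by
  classical
  have h := isDyadic_iff.1 hx
  exact ⟨Nat.find h, Nat.find_spec h, fun l hl => Nat.find_min' h hl⟩

theorem IsDyadic.cases {x : ℚ} (hx : IsDyadic x) :
    (∃ n : ℤ, x = n) ∨ ∃ k : ℕ, ∃ a : ℤ, a % 2 = 1 ∧ x = a / 2 ^ (k + 1) ∧
      ∀ l, OnGrid l x → k + 1 ≤ l := by
  obtain ⟨k, ⟨a, ha⟩, hk⟩ := hx.exists_exponent
  cases k with
  | zero => exact Or.inl ⟨a, by simpa using ha⟩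
  | succ k =>
    refine Or.inr ⟨k, a, ?_, ha, hk⟩
    by_contra h
    have h2 : k + 1 ≤ k := by
      refine hk k ⟨a / 2, ?_⟩
      rw [ha]
      obtain ⟨b, rfl⟩ : ∃ b, a = 2 * b := ⟨a / 2, by omega⟩
      rw [show 2 * b / 2 = b by omega, pow_succ]
      push_cast
      field_simp
    omega

/-! ### Canonical forms of numbers -/

theorem game_neg_neg (G : ShortGame) : - -G = G := by
  induction G with
  | mk m n L R ihL ihR =>
    change mk m n (fun i => - -L i) (fun j => - -R j) = _
    simp only [ihL, ihR]

theorem ofInt_neg_natCast (n : ℕ) : ofInt (-(n : ℤ)) = -ofNat n := by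
  cases n with
  | zero =>
    change mk 0 0 _ _ = mk 0 0 _ _
    congr 1 <;> exact Subsingleton.elim _ _
  | succ n => rfl

theorem ofInt_neg (n : ℤ) : ofInt (-n) = -ofInt n := by
  obtain ⟨m, rfl | rfl⟩ := n.eq_nat_or_neg
  · exact ofInt_neg_natCast m
  · rw [neg_neg, ofInt_neg_natCast, game_neg_neg]
    rfl

theorem ofDyadic_neg (k : ℕ) (a : ℤ) : ofDyadic k (-a) = -ofDyadic k a := by
  induction k generalizing a with
  | zero => exact ofInt_neg a
  | succ k ih =>
    rw [ofDyadic, ofDyadic]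
    by_cases h : a % 2 = 0
    · rw [if_pos h, if_pos (by omega), ← ih]
      congr 1
      omega
    · rw [if_neg h, if_neg (by omega)]
      change _ = mk 1 1 (fun _ => -ofDyadic k ((a + 1) / 2)) (fun _ => -ofDyadic k ((a - 1) / 2))
      rw [← ih, ← ih]
      rw [show (-a - 1) / 2 = -((a + 1) / 2) by omega,
        show (-a + 1) / 2 = -((a - 1) / 2) by omega]

theorem number_neg (x : ℚ) : number (-x) = -number x := by
  rw [number, number, Rat.num_neg_eq_neg_num, Rat.den_neg_eq_den, ofDyadic_neg]

theorem ofDyadic_eq_number (k : ℕ) (a : ℤ) : ofDyadic k a = number (a / 2 ^ k) := by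
  induction k generalizing a with
  | zero => simp [number, ofDyadic]
  | succ k ih =>
    rw [ofDyadic]
    split_ifs with h
    · rw [ih]
      obtain ⟨b, rfl⟩ : ∃ b, a = 2 * b := ⟨a / 2, by omega⟩
      rw [show 2 * b / 2 = b by omega, pow_succ]
      congr 1
      push_cast
      field_simp
    · have hcop : Nat.Coprime a.natAbs (2 ^ (k + 1)) := by
        refine Nat.Coprime.pow_right _ ?_
        rw [Nat.coprime_two_right, Int.natAbs_odd, Int.odd_iff]
        omega
      have hx : ((a : ℚ) / 2 ^ (k + 1)) = (a : ℚ) / ((2 ^ (k + 1) : ℤ) : ℚ) := by push_cast; rfl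
      have hnum : ((a : ℚ) / 2 ^ (k + 1)).num = a := by
        rw [hx]
        exact Rat.num_div_eq_of_coprime (by positivity) (by simpa [Int.natAbs_pow] using hcop)
      have hden : ((a : ℚ) / 2 ^ (k + 1)).den = 2 ^ (k + 1) := by
        have := Rat.den_div_eq_of_coprime (a := a) (b := 2 ^ (k + 1)) (by positivity)
          (by simpa [Int.natAbs_pow] using hcop)
        rw [← hx] at this
        exact_mod_cast this
      rw [number, hnum, hden, Nat.log_pow (by norm_num), ofDyadic, if_neg h]

theorem number_intCast (n : ℤ) : number n = ofInt n := by
  have := ofDyadic_eq_number 0 n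
  simp only [pow_zero, div_one] at this
  exact this.symm

theorem number_odd {k : ℕ} {a : ℤ} (ha : a % 2 = 1) :
    number (a / 2 ^ (k + 1)) = mk 1 1 (fun _ => number (a / 2 ^ (k + 1) - 1 / 2 ^ (k + 1)))
      (fun _ => number (a / 2 ^ (k + 1) + 1 / 2 ^ (k + 1))) := by
  rw [← ofDyadic_eq_number, ofDyadic, if_neg (by omega), ofDyadic_eq_number, ofDyadic_eq_number]
  obtain ⟨b, rfl⟩ : ∃ b, a = 2 * b + 1 := ⟨a / 2, by omega⟩
  rw [show (2 * b + 1 - 1) / 2 = b by omega, show (2 * b + 1 + 1) / 2 = b + 1 by omega, pow_succ]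
  have h₁ : (b : ℚ) / 2 ^ k =
      ((2 * b + 1 : ℤ) : ℚ) / (2 ^ k * 2) - 1 / (2 ^ k * 2) := by
    push_cast
    field_simp
    ring
  have h₂ : ((b + 1 : ℤ) : ℚ) / 2 ^ k =
      ((2 * b + 1 : ℤ) : ℚ) / (2 ^ k * 2) + 1 / (2 ^ k * 2) := by
    push_cast
    field_simp
    ring
  rw [h₁, h₂]

/-- Covers integers and fractions uniformly, so that later inductions on numbers need no case split
on the canonical form. The step is longest on the coarsest grid containing `x`, which is where a
fraction has its option; a negative integer has its option at distance `1`. -/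
theorem isRightOption_number {x : ℚ} (hx : IsDyadic x) {X : ShortGame}
    (h : IsRightOption X (number x)) : ∃ y, IsDyadic y ∧ X = number y ∧
      (∀ k, OnGrid k x → x + 1 / 2 ^ k ≤ y) ∧ (OnGrid 0 x → x < 0) := by
  rcases hx.cases with ⟨n, rfl⟩ | ⟨k, a, ha, rfl, hk⟩
  · rw [number_intCast] at h
    obtain ⟨m, rfl | rfl⟩ := n.eq_nat_or_neg
    · cases m with
      | zero => exact Fin.elim0 h.choose
      | succ m => exact Fin.elim0 h.choose
    · cases m with
      | zero => exact Fin.elim0 h.choose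
      | succ m =>
        rw [ofInt_neg_natCast] at h
        obtain ⟨j, rfl⟩ := h
        refine ⟨((-m : ℤ) : ℚ), isDyadic_intCast _, ?_, fun k _ => ?_, fun _ => ?_⟩
        · rw [number_intCast, ofInt_neg_natCast]
          rfl
        · have : (1 : ℚ) / 2 ^ k ≤ 1 := by
            rw [div_le_one (by positivity)]
            exact one_le_pow₀ (by norm_num)
          push_cast
          linarith
        · push_cast
          have : (0 : ℚ) ≤ m := m.cast_nonneg
          linarith
  · rw [number_odd ha] at h
    obtain ⟨j, rfl⟩ := h
    refine ⟨a / 2 ^ (k + 1) + 1 / 2 ^ (k + 1), ?_, rfl, fun l hl => ?_, fun h => ?_⟩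
    · exact hx.add (onGrid_one_div _).isDyadic
    · gcongr
      · norm_num
      · exact hk l hl
    · exact absurd (hk 0 h) (by omega)

theorem isLeftOption_number {x : ℚ} (hx : IsDyadic x) {X : ShortGame}
    (h : IsLeftOption X (number x)) : ∃ y, IsDyadic y ∧ X = number y ∧
      (∀ k, OnGrid k x → y ≤ x - 1 / 2 ^ k) ∧ (OnGrid 0 x → 0 < x) := by
  have h' : IsRightOption (-X) (number (-x)) := by
    rw [number_neg]
    exact isRightOption_neg.2 ⟨X, h, rfl⟩
  obtain ⟨y, hy, hX, h₁, h₂⟩ := isRightOption_number hx.neg h'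
  refine ⟨-y, hy.neg, by rw [number_neg, ← hX, game_neg_neg], fun k hk => ?_, fun hk => ?_⟩
  · linarith [h₁ k hk.neg]
  · linarith [h₂ hk.neg]

theorem IsDyadic.lt_of_right {x y : ℚ} (hx : IsDyadic x)
    (h : ∀ k, OnGrid k x → x + 1 / 2 ^ k ≤ y) : x < y := by
  obtain ⟨k, hk⟩ := isDyadic_iff.1 hx
  have : (0 : ℚ) < 1 / 2 ^ k := by positivity
  linarith [h k hk]

theorem IsDyadic.lt_of_left {x y : ℚ} (hx : IsDyadic x)
    (h : ∀ k, OnGrid k x → y ≤ x - 1 / 2 ^ k) : y < x := by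
  obtain ⟨k, hk⟩ := isDyadic_iff.1 hx
  have : (0 : ℚ) < 1 / 2 ^ k := by positivity
  linarith [h k hk]

/-- A number whose least exponent is `k` has a Right option at distance `1 / 2 ^ k`, provided that
it is negative if `k = 0`. -/
theorem exists_isRightOption_number {x : ℚ} {k : ℕ} (hx : OnGrid k x)
    (hk : ∀ l, OnGrid l x → k ≤ l) (h0 : k = 0 → x < 0) :
    IsRightOption (number (x + 1 / 2 ^ k)) (number x) := by
  rcases hx.isDyadic.cases with ⟨n, rfl⟩ | ⟨l, a, ha, rfl, hl⟩
  · have hk0 : k = 0 := Nat.le_zero.1 (hk 0 (onGrid_intCast 0 n))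
    subst hk0
    have hn : n < 0 := by exact_mod_cast h0 rfl
    obtain ⟨m, rfl⟩ : ∃ m : ℕ, n = -((m + 1 : ℕ) : ℤ) := ⟨(-n - 1).toNat, by omega⟩
    rw [number_intCast, ofInt_neg_natCast,
      show ((-((m + 1 : ℕ) : ℤ) : ℤ) : ℚ) + 1 / 2 ^ 0 = ((-(m : ℤ) : ℤ) : ℚ) by push_cast; ring,
      number_intCast, ofInt_neg_natCast]
    exact ⟨0, rfl⟩
  · obtain rfl : k = l + 1 := le_antisymm (hk _ ⟨a, rfl⟩) (hl _ hx)
    rw [number_odd ha]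
    exact ⟨0, rfl⟩

theorem exists_isLeftOption_number {x : ℚ} {k : ℕ} (hx : OnGrid k x)
    (hk : ∀ l, OnGrid l x → k ≤ l) (h0 : k = 0 → 0 < x) :
    IsLeftOption (number (x - 1 / 2 ^ k)) (number x) := by
  have h := exists_isRightOption_number hx.neg (fun l hl => hk l (by simpa using hl.neg))
    (fun h => by linarith [h0 h])
  rw [number_neg] at h
  obtain ⟨Y, hY, hXY⟩ := isRightOption_neg.1 h
  have : number (x - 1 / 2 ^ k) = Y := by
    rw [← game_neg_neg Y, ← hXY, ← number_neg]
    congr 1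
    ring
  rwa [this]

theorem number_induction {P : ℚ → Prop}
    (h : ∀ x, IsDyadic x → (∀ y, IsDyadic y → IsLeftOption (number y) (number x) → P y) →
      (∀ y, IsDyadic y → IsRightOption (number y) (number x) → P y) → P x)
    {x : ℚ} (hx : IsDyadic x) : P x := by
  have key : ∀ G x, IsDyadic x → number x = G → P x := by
    intro G
    induction G using option_induction with
    | _ G ihL ihR =>
      rintro x hx rfl
      exact h x hx (fun y hy hyx => ihL _ hyx y hy rfl) (fun y hy hyx => ihR _ hyx y hy rfl)
  exact key _ x hx rfl

/-- The number with the larger least exponent has an option one step of its own grid towards the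
other; both numbers lie on that grid, so the step does not overshoot. Only an integer `y ≤ 0` lacks
the required Left option; if `x` is then an integer too, it is negative and has a Right option. -/
theorem exists_option_between {x y : ℚ} (hx : IsDyadic x) (hy : IsDyadic y) (h : x < y) :
    (∃ z, IsDyadic z ∧ IsLeftOption (number z) (number y) ∧ x ≤ z) ∨
      ∃ z, IsDyadic z ∧ IsRightOption (number z) (number x) ∧ z ≤ y := by
  obtain ⟨k, hk, hk'⟩ := hx.exists_exponent
  obtain ⟨l, hl, hl'⟩ := hy.exists_exponent
  have hl1 : IsDyadic (y - 1 / 2 ^ l) := hy.sub (onGrid_one_div l).isDyadic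
  have hk1 : IsDyadic (x + 1 / 2 ^ k) := hx.add (onGrid_one_div k).isDyadic
  rcases le_or_gt k l with hkl | hkl
  · by_cases hc : l = 0 → 0 < y
    · refine Or.inl ⟨_, hl1, exists_isLeftOption_number hl hl' hc, ?_⟩
      linarith [(hk.mono hkl).add_le_of_lt hl h]
    · push Not at hc
      obtain ⟨rfl, hy0⟩ := hc
      obtain rfl : k = 0 := by omega
      exact Or.inr ⟨_, hk1, exists_isRightOption_number hk hk' (fun _ => by linarith),
        hk.add_le_of_lt hl h⟩
  · exact Or.inr ⟨_, hk1, exists_isRightOption_number hk hk' (fun _ => by omega),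
      hk.add_le_of_lt (hl.mono hkl.le) h⟩

/-! ### Numbers as values -/

/-- The value of the number `x`. -/
noncomputable def numberValue (x : ℚ) : Value := toValue (number x)

theorem numberValue_neg (x : ℚ) : numberValue (-x) = -numberValue x := by
  rw [numberValue, number_neg, toValue_neg, numberValue]

theorem number_le_aux {x y : ℚ} (hx : IsDyadic x) (hy : IsDyadic y) :
    (x ≤ y → number x ≤ number y) ∧ (x < y → ¬ number y ≤ number x) := by
  revert y
  refine number_induction (P := fun x => ∀ {y}, IsDyadic y →
    (x ≤ y → number x ≤ number y) ∧ (x < y → ¬ number y ≤ number x)) ?_ hx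
  intro x hx ihL ihR y hy
  refine number_induction (P := fun y =>
    (x ≤ y → number x ≤ number y) ∧ (x < y → ¬ number y ≤ number x)) ?_ hy
  intro y hy ihL' ihR'
  refine ⟨fun h => le_iff_options.2 ⟨fun X hX => ?_, fun X hX => ?_⟩, fun h => ?_⟩
  · obtain ⟨z, hz, rfl, hxz, -⟩ := isLeftOption_number hx hX
    exact (ihL z hz hX hy).2 ((hx.lt_of_left hxz).trans_le h)
  · obtain ⟨z, hz, rfl, hyz, -⟩ := isRightOption_number hy hX
    exact (ihR' z hz hX).2 (h.trans_lt (hy.lt_of_right hyz))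
  · rw [not_le_iff_options]
    rcases exists_option_between hx hy h with ⟨z, hz, hzy, hxz⟩ | ⟨z, hz, hzx, hzy⟩
    · exact Or.inl ⟨_, hzy, (ihL' z hz hzy).1 hxz⟩
    · exact Or.inr ⟨_, hzx, (ihR z hz hzx hy).1 hzy⟩

theorem numberValue_le {x y : ℚ} (hx : IsDyadic x) (hy : IsDyadic y) :
    numberValue x ≤ numberValue y ↔ x ≤ y :=
  ⟨fun h => not_lt.1 fun h' => (number_le_aux hy hx).2 h' (toValue_le.1 h),
    fun h => toValue_le.2 ((number_le_aux hx hy).1 h)⟩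

theorem numberValue_inj {x y : ℚ} (hx : IsDyadic x) (hy : IsDyadic y) :
    numberValue x = numberValue y ↔ x = y := by
  rw [le_antisymm_iff, numberValue_le hx hy, numberValue_le hy hx, ← le_antisymm_iff]

/-- Only this inequality needs an induction; the reverse one follows by negation. A Right option of
`x + y` is answered by a Right move in the summand with the finer grid, whose step is no longer than
the step of `x + y`. -/
theorem number_add_le {x y : ℚ} (hx : IsDyadic x) (hy : IsDyadic y) :
    number x + number y ≤ number (x + y) := by
  revert y
  refine number_induction (P := fun x => ∀ {y}, IsDyadic y →
    number x + number y ≤ number (x + y)) ?_ hx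
  intro x hx ihL ihR y hy
  refine number_induction (P := fun y => number x + number y ≤ number (x + y)) ?_ hy
  intro y hy ihL' ihR'
  have hxy := hx.add hy
  refine le_iff_options.2 ⟨fun X hX h => ?_, fun X hX => ?_⟩
  · rcases isLeftOption_add.1 hX with ⟨Y, hY, rfl⟩ | ⟨Y, hY, rfl⟩
    · obtain ⟨z, hz, rfl, hxz, -⟩ := isLeftOption_number hx hY
      have h2 := (number_le_aux (hz.add hy) hxy).2 (by linarith [hx.lt_of_left hxz])
      exact h2 (h.trans (ihL z hz hY hy))
    · obtain ⟨z, hz, rfl, hyz, -⟩ := isLeftOption_number hy hY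
      have h2 := (number_le_aux (hx.add hz) hxy).2 (by linarith [hy.lt_of_left hyz])
      exact h2 (h.trans (ihL' z hz hY))
  · obtain ⟨z, hz, rfl, hxz, hneg⟩ := isRightOption_number hxy hX
    rw [not_le_iff_options]
    right
    have stepx : ∀ k, OnGrid k x → OnGrid k y → (∀ l, OnGrid l x → k ≤ l) → (k = 0 → x < 0) →
        ∃ X, IsRightOption X (number x + number y) ∧ X ≤ number z := by
      intro k hkx hky hk h0
      have hopt := exists_isRightOption_number hkx hk h0
      have hd : IsDyadic (x + 1 / 2 ^ k) := hx.add (onGrid_one_div k).isDyadic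
      refine ⟨_, isRightOption_add.2 (Or.inl ⟨_, hopt, rfl⟩), (ihR _ hd hopt hy).trans ?_⟩
      exact (number_le_aux (hd.add hy) hz).1 (by linarith [hxz k (hkx.add hky)])
    have stepy : ∀ k, OnGrid k x → OnGrid k y → (∀ l, OnGrid l y → k ≤ l) → (k = 0 → y < 0) →
        ∃ X, IsRightOption X (number x + number y) ∧ X ≤ number z := by
      intro k hkx hky hk h0
      have hopt := exists_isRightOption_number hky hk h0
      have hd : IsDyadic (y + 1 / 2 ^ k) := hy.add (onGrid_one_div k).isDyadic
      refine ⟨_, isRightOption_add.2 (Or.inr ⟨_, hopt, rfl⟩), (ihR' _ hd hopt).trans ?_⟩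
      exact (number_le_aux (hx.add hd) hz).1 (by linarith [hxz k (hkx.add hky)])
    obtain ⟨k, hk, hk'⟩ := hx.exists_exponent
    obtain ⟨l, hl, hl'⟩ := hy.exists_exponent
    rcases lt_trichotomy k l with hkl | rfl | hkl
    · exact stepy l (hk.mono hkl.le) hl hl' (fun _ => by omega)
    · by_cases hx0 : k = 0 → x < 0
      · exact stepx k hk hl hk' hx0
      -- Both summands are integers here and `x ≥ 0`. As `x + y` has a Right option it is negative,
      -- which leaves `y < 0`.
      · push Not at hx0
        refine stepy k hk hl hl' fun h0 => ?_
        subst h0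
        linarith [hneg (hk.add hl)]
    · exact stepx k hk (hl.mono hkl.le) hk' (fun _ => by omega)

theorem numberValue_add {x y : ℚ} (hx : IsDyadic x) (hy : IsDyadic y) :
    numberValue (x + y) = numberValue x + numberValue y := by
  refine le_antisymm ?_ (toValue_le.2 (number_add_le hx hy))
  have h : numberValue (-x) + numberValue (-y) ≤ numberValue (-x + -y) :=
    toValue_le.2 (number_add_le hx.neg hy.neg)
  rw [← neg_add, numberValue_neg, numberValue_neg, numberValue_neg, ← neg_add] at h
  exact neg_le_neg_iff.1 h

theorem numberValue_sub {x y : ℚ} (hx : IsDyadic x) (hy : IsDyadic y) :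
    numberValue (x - y) = numberValue x - numberValue y := by
  rw [sub_eq_add_neg, numberValue_add hx hy.neg, numberValue_neg, ← sub_eq_add_neg]

theorem eqNumber_iff {G : ShortGame} {x : ℚ} :
    EqNumber G x ↔ IsDyadic x ∧ toValue G = numberValue x :=
  and_congr_right fun _ => equal_iff

theorem equal_ofInt_iff {G : ShortGame} {n : ℤ} :
    Equal G (ofInt n) ↔ toValue G = numberValue n := by
  rw [equal_iff, numberValue, number_intCast]

/-! ### Games that are bounded by, or equal to, integers -/

theorem exists_le_number (G : ShortGame) : ∃ n : ℕ, G ≤ number n := by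
  induction G with
  | mk m n L R ihL ihR =>
    choose f hf using ihL
    refine ⟨∑ i, f i + 1, le_iff_options.2 ⟨?_, fun X hX => ?_⟩⟩
    · rintro _ ⟨i, rfl⟩ h
      have hi : f i ≤ ∑ i, f i := Finset.single_le_sum (fun _ _ => Nat.zero_le _) (Finset.mem_univ i)
      refine (number_le_aux (isDyadic_natCast (f i)) (isDyadic_natCast (∑ i, f i + 1))).2 ?_
        (h.trans (hf i))
      exact_mod_cast Nat.lt_succ_of_le hi
    · obtain ⟨-, -, -, -, h⟩ := isRightOption_number (isDyadic_natCast _) hX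
      have := h (onGrid_intCast 0 (∑ i, f i + 1 : ℕ))
      exact absurd this (not_lt.2 (Nat.cast_nonneg _))

theorem exists_number_le (G : ShortGame) : ∃ n : ℕ, number (-n) ≤ G := by
  obtain ⟨n, hn⟩ := exists_le_number (-G)
  refine ⟨n, ?_⟩
  rw [number_neg, ← game_neg_neg G]
  exact neg_le_neg_of_le hn

/-- Simplest-number principle: the value is `-n` for the least `n` such that no Right option is at
most `-n`. -/
theorem exists_int_of_no_left {G : ShortGame} (h : ∀ X, ¬ IsLeftOption X G) :
    ∃ n : ℤ, toValue G = numberValue n := by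
  classical
  have hex : ∃ n : ℕ, ∀ X, IsRightOption X G → ¬ X ≤ number (-n) := by
    obtain ⟨n, hn⟩ := exists_number_le G
    exact ⟨n, fun X hX hX' => not_le_right hX (hX'.trans hn)⟩
  have hspec := Nat.find_spec hex
  have hmin : ∀ m < Nat.find hex, _ := fun m => Nat.find_min hex
  generalize Nat.find hex = n at hspec hmin
  have hd : IsDyadic (-n : ℚ) := (isDyadic_natCast n).neg
  have hg : OnGrid 0 (-n : ℚ) := (onGrid_intCast 0 (n : ℤ)).neg
  refine ⟨-n, ?_⟩
  push_cast
  rw [numberValue, toValue_eq]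
  constructor
  · refine le_iff_options.2 ⟨fun X hX => absurd hX (h X), fun X hX hXG => ?_⟩
    obtain ⟨y, hy, rfl, hy1, hy2⟩ := isRightOption_number hd hX
    have hn : 0 < (n : ℚ) := by linarith [hy2 hg]
    have hn' : 0 < n := by exact_mod_cast hn
    obtain ⟨m, rfl⟩ : ∃ m, n = m + 1 := ⟨n - 1, by omega⟩
    -- Minimality supplies a Right option of `G` at most `-m = -n + 1`, hence below the Right option
    -- `y` of `-n`.
    have := hmin m (Nat.lt_succ_self m)
    push Not at this
    obtain ⟨Y, hY, hYm⟩ := this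
    refine not_le_right hY ((hYm.trans ?_).trans hXG)
    refine (number_le_aux (isDyadic_natCast m).neg hy).1 ?_
    have := hy1 0 hg
    push_cast at this
    linarith
  · refine le_iff_options.2 ⟨fun X hX => ?_, hspec⟩
    obtain ⟨-, -, -, -, hy2⟩ := isLeftOption_number hd hX
    have := hy2 hg
    have h0 : (0 : ℚ) ≤ n := n.cast_nonneg
    linarith

theorem exists_int_of_no_right {G : ShortGame} (h : ∀ X, ¬ IsRightOption X G) :
    ∃ n : ℤ, toValue G = numberValue n := by
  obtain ⟨n, hn⟩ := exists_int_of_no_left (G := -G) fun X hX =>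
    let ⟨Y, hY, _⟩ := isLeftOption_neg.1 hX
    h Y hY
  refine ⟨-n, ?_⟩
  push_cast
  rw [numberValue_neg, ← hn, toValue_neg, neg_neg]

/-! ### Stops -/

/-- The largest Right stop of a Left option. -/
noncomputable def leftScaffold : ShortGame → ℝ
  | mk _ _ L _ => ⨆ i, rightStop (L i)

/-- The smallest Left stop of a Right option. -/
noncomputable def rightScaffold : ShortGame → ℝ
  | mk _ _ _ R => ⨅ j, leftStop (R j)

theorem le_leftScaffold {X G : ShortGame} (h : IsLeftOption X G) :
    rightStop X ≤ leftScaffold G := by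
  cases G with
  | mk m n L R =>
    obtain ⟨i, rfl⟩ := h
    exact le_ciSup (f := fun i => rightStop (L i)) (Set.finite_range _).bddAbove i

theorem rightScaffold_le {X G : ShortGame} (h : IsRightOption X G) :
    rightScaffold G ≤ leftStop X := by
  cases G with
  | mk m n L R =>
    obtain ⟨i, rfl⟩ := h
    exact ciInf_le (f := fun i => leftStop (R i)) (Set.finite_range _).bddBelow i

theorem exists_eq_leftScaffold {G : ShortGame} (h : ∃ X, IsLeftOption X G) :
    ∃ X, IsLeftOption X G ∧ rightStop X = leftScaffold G := by
  cases G with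
  | mk m n L R =>
    obtain ⟨_, i, -⟩ := h
    have : Nonempty (Fin m) := ⟨i⟩
    obtain ⟨j, hj⟩ := exists_eq_ciSup_of_finite (f := fun i => rightStop (L i))
    exact ⟨L j, ⟨j, rfl⟩, hj⟩

theorem exists_eq_rightScaffold {G : ShortGame} (h : ∃ X, IsRightOption X G) :
    ∃ X, IsRightOption X G ∧ leftStop X = rightScaffold G := by
  cases G with
  | mk m n L R =>
    obtain ⟨_, i, -⟩ := h
    have : Nonempty (Fin n) := ⟨i⟩
    obtain ⟨j, hj⟩ := exists_eq_ciInf_of_finite (f := fun i => leftStop (R i))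
    exact ⟨R j, ⟨j, rfl⟩, hj⟩

/-- `G` has the value of a number. -/
def IsNumber (G : ShortGame) : Prop := ∃ x, IsDyadic x ∧ toValue G = numberValue x

theorem stops_of_eq {G : ShortGame} {x : ℚ} (hx : IsDyadic x) (h : toValue G = numberValue x) :
    leftStop G = x ∧ rightStop G = x := by
  have hex : ∃ x, EqNumber G x := ⟨x, eqNumber_iff.2 ⟨hx, h⟩⟩
  have hch : hex.choose = x := by
    have h' := eqNumber_iff.1 hex.choose_spec
    exact (numberValue_inj h'.1 hx).1 (h'.2.symm.trans h)
  cases G with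
  | mk m n L R =>
    rw [leftStop, rightStop, dif_pos hex, dif_pos hex, hch]
    exact ⟨rfl, rfl⟩

theorem stops_of_not_isNumber {G : ShortGame} (h : ¬ IsNumber G) :
    leftStop G = leftScaffold G ∧ rightStop G = rightScaffold G := by
  have hex : ¬ ∃ x, EqNumber G x := fun ⟨x, hx⟩ => h ⟨x, eqNumber_iff.1 hx⟩
  cases G with
  | mk m n L R =>
    rw [leftStop, rightStop, dif_neg hex, dif_neg hex]
    exact ⟨rfl, rfl⟩

/-- Keeps the suprema in the stops off their default value on empty families. -/
theorem exists_isLeftOption_of_ne_int {G : ShortGame} (h : ¬ ∃ n : ℤ, toValue G = numberValue n) :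
    ∃ X, IsLeftOption X G := by
  by_contra h'
  push Not at h'
  exact h (exists_int_of_no_left h')

theorem exists_isRightOption_of_ne_int {G : ShortGame} (h : ¬ ∃ n : ℤ, toValue G = numberValue n) :
    ∃ X, IsRightOption X G := by
  by_contra h'
  push Not at h'
  exact h (exists_int_of_no_right h')

theorem not_int_of_not_isNumber {G : ShortGame} (h : ¬ IsNumber G) :
    ¬ ∃ n : ℤ, toValue G = numberValue n :=
  fun ⟨n, hn⟩ => h ⟨n, isDyadic_intCast n, hn⟩

/-- The stops are the ends of the cut that a game makes in the numbers. -/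
theorem stops_cut (G : ShortGame) {u : ℚ} (hu : IsDyadic u) :
    (((u : ℝ) < leftStop G → ¬ G ≤ number u) ∧ (leftStop G < u → G ≤ number u)) ∧
      ((rightStop G < u → ¬ number u ≤ G) ∧ ((u : ℝ) < rightStop G → number u ≤ G)) := by
  induction G using option_induction generalizing u with
  | _ G ihL ihR =>
    by_cases hG : IsNumber G
    · obtain ⟨x, hx, hGx⟩ := hG
      rw [(stops_of_eq hx hGx).1, (stops_of_eq hx hGx).2]
      simp only [← toValue_le]
      have hnv : toValue (number u) = numberValue u := rfl
      rw [hGx, hnv, numberValue_le hx hu, numberValue_le hu hx, not_le, not_le]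
      simp only [Rat.cast_lt]
      exact ⟨⟨id, le_of_lt⟩, id, le_of_lt⟩
    · have hint := not_int_of_not_isNumber hG
      obtain ⟨hl, hr⟩ := stops_of_not_isNumber hG
      have hnum : ∀ {v w}, IsDyadic v → IsDyadic w → v ≤ w → G ≤ number v → ¬ number w ≤ G := by
        intro v w hv hw hvw h₁ h₂
        exact hG ⟨v, hv, toValue_eq.2 ⟨h₁, ((number_le_aux hv hw).1 hvw).trans h₂⟩⟩
      refine ⟨⟨fun h => ?_, ?_⟩, ⟨fun h => ?_, ?_⟩⟩
      · obtain ⟨X, hX, hXG⟩ := exists_eq_leftScaffold (exists_isLeftOption_of_ne_int hint)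
        exact fun h' => not_le_left hX (h'.trans ((ihL X hX hu).2.2 (by rw [hXG, ← hl]; exact h)))
      -- An inner induction on `u` is needed because `G ≤ u` also forbids Right options `y` of `u`
      -- with `y ≤ G`. Such a `y` exceeds `u`, so `G ≤ y` by induction, and `G` would equal the
      -- number `y`.
      · refine number_induction (P := fun u => leftStop G < u → G ≤ number u) ?_ hu
        intro u hu _ ihu h
        refine le_iff_options.2 ⟨fun X hX => (ihL X hX hu).2.1 ?_, fun X hX => ?_⟩
        · exact (hl ▸ le_leftScaffold hX).trans_lt h
        · obtain ⟨y, hy, rfl, huy, -⟩ := isRightOption_number hu hX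
          have huy' : (u : ℝ) < y := by exact_mod_cast hu.lt_of_right huy
          exact hnum hy hy le_rfl (ihu y hy hX (h.trans huy'))
      · obtain ⟨X, hX, hXG⟩ := exists_eq_rightScaffold (exists_isRightOption_of_ne_int hint)
        exact fun h' => not_le_right hX (((ihR X hX hu).1.2 (by rw [hXG, ← hr]; exact h)).trans h')
      · refine number_induction (P := fun u => ((u : ℚ) : ℝ) < rightStop G → number u ≤ G) ?_ hu
        intro u hu ihu _ h
        refine le_iff_options.2 ⟨fun X hX => ?_, fun X hX => (ihR X hX hu).1.1 ?_⟩
        · obtain ⟨y, hy, rfl, huy, -⟩ := isLeftOption_number hu hX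
          have huy' : (y : ℝ) < u := by exact_mod_cast hu.lt_of_left huy
          exact fun h' => hnum hy hy le_rfl h' (ihu y hy hX (huy'.trans h))
        · exact h.trans_le (hr ▸ rightScaffold_le hX)

theorem not_le_of_lt_leftStop {G : ShortGame} {u : ℚ} (hu : IsDyadic u) (h : (u : ℝ) < leftStop G) :
    ¬ toValue G ≤ numberValue u := fun h' => (stops_cut G hu).1.1 h (toValue_le.1 h')

theorem le_of_leftStop_lt {G : ShortGame} {u : ℚ} (hu : IsDyadic u) (h : leftStop G < u) :
    toValue G ≤ numberValue u := toValue_le.2 ((stops_cut G hu).1.2 h)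

theorem not_le_of_rightStop_lt {G : ShortGame} {u : ℚ} (hu : IsDyadic u) (h : rightStop G < u) :
    ¬ numberValue u ≤ toValue G := fun h' => (stops_cut G hu).2.1 h (toValue_le.1 h')

theorem le_of_lt_rightStop {G : ShortGame} {u : ℚ} (hu : IsDyadic u) (h : (u : ℝ) < rightStop G) :
    numberValue u ≤ toValue G := toValue_le.2 ((stops_cut G hu).2.2 h)

/-- A dyadic `u` strictly between the stops in the wrong order would satisfy `G ≤ u ≤ G`, making
both stops equal to `u`. -/
theorem rightStop_le_leftStop (G : ShortGame) : rightStop G ≤ leftStop G := by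
  by_contra! h
  obtain ⟨u, hu, h₁, h₂⟩ := exists_isDyadic_between h
  have := stops_of_eq hu (le_antisymm (le_of_leftStop_lt hu h₁) (le_of_lt_rightStop hu h₂))
  linarith [this.1]

/-- The stop is determined by comparisons with numbers, and these translate. In particular stops
depend only on the value of a game. -/
theorem leftStop_add_number {G H : ShortGame} {u : ℚ} (hu : IsDyadic u)
    (h : toValue H = toValue G + numberValue u) : leftStop H = leftStop G + u := by
  refine le_antisymm ?_ ?_ <;> by_contra! hlt <;>
    obtain ⟨v, hv, h₁, h₂⟩ := exists_isDyadic_between hlt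
  · refine not_le_of_lt_leftStop hv h₂ ?_
    rw [h, ← le_sub_iff_add_le, ← numberValue_sub hv hu]
    exact le_of_leftStop_lt (hv.sub hu) (by push_cast; linarith)
  · refine not_le_of_lt_leftStop (hv.sub hu) (by push_cast; linarith) ?_
    rw [numberValue_sub hv hu, le_sub_iff_add_le, ← h]
    exact le_of_leftStop_lt hv h₁

theorem rightStop_add_number {G H : ShortGame} {u : ℚ} (hu : IsDyadic u)
    (h : toValue H = toValue G + numberValue u) : rightStop H = rightStop G + u := by
  refine le_antisymm ?_ ?_ <;> by_contra! hlt <;>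
    obtain ⟨v, hv, h₁, h₂⟩ := exists_isDyadic_between hlt
  · refine not_le_of_rightStop_lt (G := G) (hv.sub hu) (by push_cast; linarith) ?_
    rw [numberValue_sub hv hu, sub_le_iff_le_add, ← h]
    exact le_of_lt_rightStop hv h₂
  · refine not_le_of_rightStop_lt hv h₁ ?_
    rw [h, ← sub_le_iff_le_add, ← numberValue_sub hv hu]
    exact le_of_lt_rightStop (hv.sub hu) (by push_cast; linarith)

theorem infCloseNumber_iff {G : ShortGame} {x : ℚ} :
    InfCloseNumber G x ↔ IsDyadic x ∧ leftStop G = x ∧ rightStop G = x := by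
  refine and_congr_right fun hx => ?_
  have h : toValue (G - number x) = toValue G + numberValue (-x) := by
    rw [toValue_sub, numberValue_neg, ← sub_eq_add_neg]
    rfl
  rw [InfClose, leftStop_add_number hx.neg h, rightStop_add_number hx.neg h]
  push_cast
  rw [add_neg_eq_zero, add_neg_eq_zero]

theorem exists_isDyadic_stops (G : ShortGame) :
    (∃ x, IsDyadic x ∧ leftStop G = x) ∧ ∃ x, IsDyadic x ∧ rightStop G = x := by
  induction G using option_induction with
  | _ G ihL ihR =>
    by_cases hG : IsNumber G
    · obtain ⟨x, hx, hGx⟩ := hG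
      exact ⟨⟨x, hx, (stops_of_eq hx hGx).1⟩, ⟨x, hx, (stops_of_eq hx hGx).2⟩⟩
    · have hint := not_int_of_not_isNumber hG
      rw [(stops_of_not_isNumber hG).1, (stops_of_not_isNumber hG).2]
      obtain ⟨X, hX, hXG⟩ := exists_eq_leftScaffold (exists_isLeftOption_of_ne_int hint)
      obtain ⟨Y, hY, hYG⟩ := exists_eq_rightScaffold (exists_isRightOption_of_ne_int hint)
      rw [← hXG, ← hYG]
      exact ⟨(ihL X hX).2, (ihR Y hY).1⟩

/-! ### Scaffolds -/

theorem leftScaffold_le_of_eq {G : ShortGame} (hL : ∃ X, IsLeftOption X G) {x : ℚ}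
    (hx : IsDyadic x) (h : toValue G = numberValue x) : leftScaffold G ≤ x := by
  obtain ⟨X, hX, hXG⟩ := exists_eq_leftScaffold hL
  rw [← hXG]
  by_contra! hlt
  refine not_le_left hX (toValue_le.1 ?_)
  rw [h]
  exact le_of_lt_rightStop hx hlt

theorem le_rightScaffold_of_eq {G : ShortGame} (hR : ∃ X, IsRightOption X G) {x : ℚ}
    (hx : IsDyadic x) (h : toValue G = numberValue x) : x ≤ rightScaffold G := by
  obtain ⟨X, hX, hXG⟩ := exists_eq_rightScaffold hR
  rw [← hXG]
  by_contra! hlt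
  refine not_le_right hX (toValue_le.1 ?_)
  rw [h]
  exact le_of_leftStop_lt hx hlt

theorem leftScaffold_le_leftStop {G : ShortGame} (hL : ∃ X, IsLeftOption X G) :
    leftScaffold G ≤ leftStop G := by
  by_cases hG : IsNumber G
  · obtain ⟨x, hx, h⟩ := hG
    rw [(stops_of_eq hx h).1]
    exact leftScaffold_le_of_eq hL hx h
  · exact (stops_of_not_isNumber hG).1.ge

theorem rightStop_le_rightScaffold {G : ShortGame} (hR : ∃ X, IsRightOption X G) :
    rightStop G ≤ rightScaffold G := by
  by_cases hG : IsNumber G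
  · obtain ⟨x, hx, h⟩ := hG
    rw [(stops_of_eq hx h).2]
    exact le_rightScaffold_of_eq hR hx h
  · exact (stops_of_not_isNumber hG).2.le

theorem rightScaffold_le_leftScaffold {G : ShortGame} (hG : ¬ IsNumber G) :
    rightScaffold G ≤ leftScaffold G := by
  rw [← (stops_of_not_isNumber hG).1, ← (stops_of_not_isNumber hG).2]
  exact rightStop_le_leftStop G

theorem InfCloseNumber.scaffolds {G : ShortGame} (hL : ∃ X, IsLeftOption X G)
    (hR : ∃ X, IsRightOption X G) {z : ℚ} (h : InfCloseNumber G z) :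
    leftScaffold G ≤ z ∧ z ≤ rightScaffold G := by
  obtain ⟨-, h₁, h₂⟩ := infCloseNumber_iff.1 h
  exact ⟨h₁ ▸ leftScaffold_le_leftStop hL, h₂ ▸ rightStop_le_rightScaffold hR⟩

/-- For a non-number the scaffolds are the stops, already ordered the other way, so the inequality
forces them to coincide. A number always lies between its scaffolds. Temperature thus becomes a
question about where two real functions meet. -/
theorem exists_infCloseNumber_iff {G : ShortGame} (hL : ∃ X, IsLeftOption X G)
    (hR : ∃ X, IsRightOption X G) :
    (∃ z, InfCloseNumber G z) ↔ leftScaffold G ≤ rightScaffold G := by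
  constructor
  · rintro ⟨z, hz⟩
    exact (hz.scaffolds hL hR).1.trans (hz.scaffolds hL hR).2
  · intro h
    by_cases hG : IsNumber G
    · obtain ⟨x, hx, hGx⟩ := hG
      exact ⟨x, infCloseNumber_iff.2 ⟨hx, stops_of_eq hx hGx⟩⟩
    · obtain ⟨x, hx, hGx⟩ := (exists_isDyadic_stops G).1
      obtain ⟨h₁, h₂⟩ := stops_of_not_isNumber hG
      refine ⟨x, infCloseNumber_iff.2 ⟨hx, hGx, ?_⟩⟩
      rw [← hGx, h₁, h₂]
      exact le_antisymm (rightScaffold_le_leftScaffold hG) h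

theorem stops_of_scaffold_lt {G : ShortGame} (hL : ∃ X, IsLeftOption X G)
    (hR : ∃ X, IsRightOption X G) (h : rightScaffold G < leftScaffold G) :
    leftStop G = leftScaffold G ∧ rightStop G = rightScaffold G := by
  refine stops_of_not_isNumber fun ⟨x, hx, hGx⟩ => h.not_ge ?_
  exact (leftScaffold_le_of_eq hL hx hGx).trans (le_rightScaffold_of_eq hR hx hGx)

/-! ### Walls of thermographs -/

/-- A function of dyadic `t ≥ -1` that behaves like the left wall of a thermograph: it is
nonincreasing and `1`-Lipschitz, and to the left of every point it is affine with dyadic constant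
term and slope `0` or `-1`. -/
structure Wall (g : ℚ → ℝ) : Prop where
  anti : ∀ ⦃s t : ℚ⦄, IsDyadic s → IsDyadic t → -1 ≤ s → s ≤ t → g t ≤ g s
  lipschitz : ∀ ⦃s t : ℚ⦄, IsDyadic s → IsDyadic t → -1 ≤ s → s ≤ t → g s ≤ g t + (t - s)
  germ : ∀ σ : ℝ, -1 < σ → ∃ a : ℚ, IsDyadic a ∧ ∃ e : ℝ, (e = 0 ∨ e = 1) ∧
    ∀ᶠ x : ℝ in 𝓝[<] σ, ∀ t : ℚ, (t : ℝ) = x → IsDyadic t → -1 ≤ t → g t = a - e * t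

namespace Wall

theorem congr {g h : ℚ → ℝ} (hg : Wall g) (H : ∀ t, IsDyadic t → -1 ≤ t → h t = g t) : Wall h where
  anti s t hs ht h1 hst := by
    rw [H s hs h1, H t ht (h1.trans hst)]
    exact hg.anti hs ht h1 hst
  lipschitz s t hs ht h1 hst := by
    rw [H s hs h1, H t ht (h1.trans hst)]
    exact hg.lipschitz hs ht h1 hst
  germ σ hσ := by
    obtain ⟨a, ha, e, he, h⟩ := hg.germ σ hσ
    refine ⟨a, ha, e, he, ?_⟩
    filter_upwards [h] with x hx t htx ht h1
    rw [H t ht h1, hx t htx ht h1]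

theorem const {a : ℚ} (ha : IsDyadic a) : Wall fun _ => a where
  anti _ _ _ _ _ _ := le_rfl
  lipschitz s t _ _ _ hst := by
    have : (s : ℝ) ≤ t := by exact_mod_cast hst
    linarith
  germ σ _ := ⟨a, ha, 0, Or.inl rfl, Eventually.of_forall fun x t _ _ _ => by ring⟩

/-- The effect of the tax: from the wall `-RS(X_t)` of a Left option it makes `RS(X_t) - t`, a
contribution to the left scaffold. Monotonicity and the Lipschitz bound exchange roles, and so do
the slopes `0` and `-1`. -/
theorem flip {g : ℚ → ℝ} (hg : Wall g) : Wall fun t => -g t - t where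
  anti s t hs ht h1 hst := by linarith [hg.lipschitz hs ht h1 hst]
  lipschitz s t hs ht h1 hst := by linarith [hg.anti hs ht h1 hst]
  germ σ hσ := by
    obtain ⟨a, ha, e, he, h⟩ := hg.germ σ hσ
    refine ⟨-a, ha.neg, 1 - e, ?_, ?_⟩
    · rcases he with rfl | rfl <;> simp
    · filter_upwards [h] with x hx t htx ht h1
      rw [hx t htx ht h1]
      push_cast
      ring

theorem eventually_sign (c e σ : ℝ) :
    (∀ᶠ x in 𝓝[<] σ, c - e * x ≤ 0) ∨ ∀ᶠ x in 𝓝[<] σ, 0 ≤ c - e * x := by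
  have hcont : Tendsto (fun x => c - e * x) (𝓝[<] σ) (𝓝 (c - e * σ)) :=
    (Continuous.tendsto (by fun_prop) σ).mono_left nhdsWithin_le_nhds
  rcases lt_trichotomy (c - e * σ) 0 with h | h | h
  · exact Or.inl ((hcont.eventually_lt_const h).mono fun _ => le_of_lt)
  · rcases le_total e 0 with he | he
    · left
      filter_upwards [self_mem_nhdsWithin] with x hx
      have : x < σ := hx
      nlinarith
    · right
      filter_upwards [self_mem_nhdsWithin] with x hx
      have : x < σ := hx
      nlinarith
  · exact Or.inr ((hcont.eventually_const_lt h).mono fun _ => le_of_lt)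

/-- Two affine functions are comparable just left of `σ`, so a finite family has a dominating member
there. This keeps germs affine under finite maxima. -/
theorem exists_eventually_max {ι : Type*} [Finite ι] [Nonempty ι] (a e : ι → ℝ) (σ : ℝ) :
    ∃ i, ∀ᶠ x in 𝓝[<] σ, ∀ j, a j - e j * x ≤ a i - e i * x := by
  classical
  have := Fintype.ofFinite ι
  have key : ∀ s : Finset ι, s.Nonempty →
      ∃ i, ∀ᶠ x in 𝓝[<] σ, ∀ j ∈ s, a j - e j * x ≤ a i - e i * x := by
    intro s hs
    induction hs using Finset.Nonempty.cons_induction with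
    | singleton i => exact ⟨i, Eventually.of_forall fun x j hj => by rw [Finset.mem_singleton.1 hj]⟩
    | cons k s hk hs ih =>
      obtain ⟨i, hi⟩ := ih
      rcases eventually_sign (a k - a i) (e k - e i) σ with h | h
      · refine ⟨i, ?_⟩
        filter_upwards [hi, h] with x hx hx' j hj
        rcases Finset.mem_cons.1 hj with rfl | hj
        · linarith
        · exact hx j hj
      · refine ⟨k, ?_⟩
        filter_upwards [hi, h] with x hx hx' j hj
        rcases Finset.mem_cons.1 hj with rfl | hj
        · exact le_rfl
        · linarith [hx j hj]
  obtain ⟨i, hi⟩ := key Finset.univ Finset.univ_nonempty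
  exact ⟨i, hi.mono fun x hx j => hx j (Finset.mem_univ j)⟩

theorem max {ι : Type*} [Finite ι] {g : ι → ℚ → ℝ} (hg : ∀ i, Wall (g i)) {m : ℚ → ℝ}
    (hle : ∀ i t, g i t ≤ m t) (hex : ∀ t, ∃ i, g i t = m t) : Wall m where
  anti s t hs ht h1 hst := by
    obtain ⟨i, hi⟩ := hex t
    rw [← hi]
    exact ((hg i).anti hs ht h1 hst).trans (hle i s)
  lipschitz s t hs ht h1 hst := by
    obtain ⟨i, hi⟩ := hex s
    rw [← hi]
    linarith [(hg i).lipschitz hs ht h1 hst, hle i t]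
  germ σ hσ := by
    have : Nonempty ι := ⟨(hex 0).choose⟩
    choose a ha e he h using fun i => (hg i).germ σ hσ
    obtain ⟨i, hi⟩ := exists_eventually_max (fun i => (a i : ℝ)) e σ
    refine ⟨a i, ha i, e i, he i, ?_⟩
    filter_upwards [hi, eventually_all.2 h] with x hx hx' t htx ht h1
    obtain ⟨j, hj⟩ := hex t
    refine le_antisymm ?_ ?_
    · rw [← hj, hx' j t htx ht h1, htx]
      exact hx j
    · rw [← hx' i t htx ht h1]
      exact hle i t

/-- Erecting the mast. Continuity at `s` is required only for `s > -1`, since nothing lies to the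
left of `-1`. -/
theorem truncate {g h : ℚ → ℝ} (hg : Wall g) {s y : ℚ} (hs : IsDyadic s) (hy : IsDyadic y)
    (hsy : -1 < s → g s = y) (hlt : ∀ t, IsDyadic t → -1 ≤ t → t < s → h t = g t)
    (hge : ∀ t, IsDyadic t → s ≤ t → h t = y) : Wall h where
  anti t u ht hu h1 htu := by
    rcases lt_or_ge u s with hus | hus
    · rw [hlt t ht h1 (htu.trans_lt hus), hlt u hu (h1.trans htu) hus]
      exact hg.anti ht hu h1 htu
    · rw [hge u hu hus]
      rcases lt_or_ge t s with hts | hts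
      · rw [hlt t ht h1 hts, ← hsy (h1.trans_lt hts)]
        exact hg.anti ht hs h1 hts.le
      · rw [hge t ht hts]
  lipschitz t u ht hu h1 htu := by
    have htu' : (t : ℝ) ≤ u := by exact_mod_cast htu
    rcases lt_or_ge u s with hus | hus
    · rw [hlt t ht h1 (htu.trans_lt hus), hlt u hu (h1.trans htu) hus]
      exact hg.lipschitz ht hu h1 htu
    · rw [hge u hu hus]
      have hus' : (s : ℝ) ≤ u := by exact_mod_cast hus
      rcases lt_or_ge t s with hts | hts
      · rw [hlt t ht h1 hts, ← hsy (h1.trans_lt hts)]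
        linarith [hg.lipschitz ht hs h1 hts.le]
      · rw [hge t ht hts]
        linarith
  germ σ hσ := by
    rcases le_or_gt σ s with hσs | hσs
    · obtain ⟨a, ha, e, he, hev⟩ := hg.germ σ hσ
      refine ⟨a, ha, e, he, ?_⟩
      filter_upwards [hev, self_mem_nhdsWithin] with x hx hxσ t htx ht h1
      have hts : (t : ℝ) < s := htx ▸ (lt_of_lt_of_le hxσ hσs)
      rw [hlt t ht h1 (by exact_mod_cast hts), hx t htx ht h1]
    · refine ⟨y, hy, 0, Or.inl rfl, ?_⟩
      filter_upwards [mem_nhdsWithin_of_mem_nhds (Ioi_mem_nhds hσs)] with x hx t htx ht h1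
      have hts : (s : ℝ) < t := htx ▸ hx
      rw [hge t ht (by exact_mod_cast hts.le)]
      ring

-- Where two walls meet

section Meet

variable {f g : ℚ → ℝ}

/-- Two walls that cross do so at a dyadic point: there is a smallest dyadic `t ≥ -1` with
`f t + g t ≤ 0`. -/
theorem exists_isLeast (hf : Wall f) (hg : Wall g) {C : Set ℚ}
    (hC : ∀ t, t ∈ C ↔ IsDyadic t ∧ -1 ≤ t ∧ f t + g t ≤ 0) (hne : C.Nonempty) :
    ∃ s, IsLeast C s := by
  set σ : ℝ := sInf ((fun t : ℚ => (t : ℝ)) '' C) with hσdef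
  have hbdd : BddBelow ((fun t : ℚ => (t : ℝ)) '' C) := by
    refine ⟨-1, ?_⟩
    rintro _ ⟨t, ht, rfl⟩
    have h := ((hC t).1 ht).2.1
    change (-1 : ℝ) ≤ (t : ℝ)
    exact_mod_cast h
  have hle : ∀ t ∈ C, σ ≤ t := fun t ht => csInf_le hbdd ⟨t, ht, rfl⟩
  have happ : ∀ ε : ℝ, 0 < ε → ∃ t ∈ C, (t : ℝ) < σ + ε := by
    intro ε hε
    obtain ⟨_, ⟨t, ht, rfl⟩, h⟩ := exists_lt_of_csInf_lt (hne.image _) (lt_add_of_pos_right σ hε)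
    exact ⟨t, ht, h⟩
  have hσ1 : -1 ≤ σ := by
    refine le_csInf (hne.image _) ?_
    rintro _ ⟨t, ht, rfl⟩
    have h := ((hC t).1 ht).2.1
    change (-1 : ℝ) ≤ (t : ℝ)
    exact_mod_cast h
  -- `f + g` drops at rate at most `2` and is nonpositive at points of `C` arbitrarily close to `σ`.
  have hbound : ∀ t : ℚ, IsDyadic t → -1 ≤ t → (t : ℝ) ≤ σ → f t + g t ≤ 2 * (σ - t) := by
    intro t ht h1 htσ
    refine le_of_forall_pos_le_add fun ε hε => ?_
    obtain ⟨u, hu, huσ⟩ := happ (ε / 2) (by positivity)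
    obtain ⟨hud, -, hfu⟩ := (hC u).1 hu
    have htu : t ≤ u := by exact_mod_cast htσ.trans (hle u hu)
    linarith [hf.lipschitz ht hud h1 htu, hg.lipschitz ht hud h1 htu]
  -- Once the infimum is dyadic, `hbound` at `t = σ` shows that it belongs to `C`.
  suffices h : ∃ s : ℚ, IsDyadic s ∧ (s : ℝ) = σ by
    obtain ⟨s, hs, hsσ⟩ := h
    have h1 : -1 ≤ s := by
      rw [← hsσ] at hσ1
      exact_mod_cast hσ1
    refine ⟨s, (hC s).2 ⟨hs, h1, ?_⟩, fun t ht => ?_⟩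
    · have := hbound s hs h1 hsσ.le
      rwa [hsσ, sub_self, mul_zero] at this
    · have := hle t ht
      rw [← hsσ] at this
      exact_mod_cast this
  rcases hσ1.eq_or_lt with h | h
  · exact ⟨-1, isDyadic_natCast 1 |>.neg |> fun h => by simpa using h, by rw [← h]; norm_num⟩
  · obtain ⟨a, ha, e, he, hfe⟩ := hf.germ σ h
    obtain ⟨b, hb, d, hd, hgd⟩ := hg.germ σ h
    obtain ⟨τ, hτσ, hτ⟩ := mem_nhdsLT_iff_exists_Ioo_subset.1 (hfe.and hgd)
    have hnear : ∀ ε : ℝ, 0 < ε → ∃ t : ℚ, (t : ℝ) < σ ∧ σ - t < ε ∧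
        0 < (a + b) - (e + d) * t ∧ (a + b) - (e + d) * t ≤ 2 * (σ - t) := by
      intro ε hε
      obtain ⟨t, ht, ht1, ht2⟩ := exists_isDyadic_between
        (show Max.max (Max.max (-1) τ) (σ - ε) < σ by
          simp only [max_lt_iff]
          exact ⟨⟨h, hτσ⟩, by linarith⟩)
      simp only [max_lt_iff] at ht1
      have h1 : -1 ≤ t := by exact_mod_cast ht1.1.1.le
      have hmem := hτ ⟨ht1.1.2, ht2⟩
      have e1 := hmem.1 t rfl ht h1
      have e2 := hmem.2 t rfl ht h1
      have hsum : f t + g t = (a + b) - (e + d) * t := by rw [e1, e2]; ring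
      refine ⟨t, ht2, by linarith [ht1.2], ?_, ?_⟩
      · rw [← hsum]
        by_contra! hn
        exact (hle t ((hC t).2 ⟨ht, h1, hn⟩)).not_gt ht2
      · rw [← hsum]
        exact hbound t ht h1 ht2.le
    have he0 : 0 ≤ e + d ∧ e + d ≤ 2 := by
      rcases he with rfl | rfl <;> rcases hd with rfl | rfl <;> norm_num
    -- Just left of `σ` the affine sum is positive but at most `2 * (σ - t)`, so it vanishes at `σ`.
    have hzero : ((a : ℝ) + b) - (e + d) * σ = 0 := by
      by_contra hne0
      obtain ⟨t, ht, hε, hp, hu⟩ := hnear (|((a : ℝ) + b) - (e + d) * σ| / 2)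
        (by have := abs_pos.2 hne0; positivity)
      rcases abs_cases (((a : ℝ) + b) - (e + d) * σ) with ⟨h1, h2⟩ | ⟨h1, h2⟩ <;>
        rw [h1] at hε <;> nlinarith
    -- Total slope `0` contradicts positivity left of `σ`; otherwise `σ` is `a + b` or `(a + b) /
    -- 2`, both dyadic.
    have hsum : e + d = 0 ∨ e + d = 1 ∨ e + d = 2 := by
      rcases he with rfl | rfl <;> rcases hd with rfl | rfl <;> norm_num
    rcases hsum with h0 | h0 | h0 <;> rw [h0] at hzero
    · obtain ⟨t, -, -, hp, -⟩ := hnear 1 one_pos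
      rw [h0] at hp
      linarith
    · exact ⟨a + b, ha.add hb, by push_cast; linarith⟩
    · exact ⟨(a + b) / 2, (ha.add hb).half, by push_cast; linarith⟩

theorem add_eq_zero_of_isLeast (hf : Wall f) (hg : Wall g) {C : Set ℚ}
    (hC : ∀ t, t ∈ C ↔ IsDyadic t ∧ -1 ≤ t ∧ f t + g t ≤ 0) {s : ℚ} (hs : IsLeast C s)
    (h1 : -1 < s) : f s + g s = 0 := by
  obtain ⟨hsd, -, hfs⟩ := (hC s).1 hs.1
  refine le_antisymm hfs ?_
  by_contra! hlt
  have h1' : (-1 : ℝ) < s := by exact_mod_cast h1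
  -- Moving left from `s` raises the sum by at most `2 * (s - t)`, so such a `t` would still belong
  -- to `C`.
  obtain ⟨t, ht, ht1, ht2⟩ := exists_isDyadic_between
    (show Max.max (-1 : ℝ) (s + (f s + g s) / 2) < s by
      rw [max_lt_iff]
      exact ⟨h1', by linarith⟩)
  rw [max_lt_iff] at ht1
  have h1t : -1 ≤ t := by exact_mod_cast ht1.1.le
  have hts : t < s := by exact_mod_cast ht2
  refine (hs.2 ((hC t).2 ⟨ht, h1t, ?_⟩)).not_gt hts
  linarith [hf.lipschitz ht hsd h1t hts.le, hg.lipschitz ht hsd h1t hts.le]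

end Meet

end Wall

/-! ### Cooling -/

/-- `{(G^L)_t - t | (G^R)_t + t}`. -/
noncomputable def precool : ShortGame → ℚ → ShortGame
  | mk m n L R => fun t =>
    mk m n (fun i => cool (L i) t - number t) (fun j => cool (R j) t + number t)

theorem cool_eq_coolStep (G : ShortGame) : cool G = coolStep G (precool G) := by
  cases G with
  | mk m n L R => rw [cool]; rfl

theorem isLeftOption_precool {G X : ShortGame} {t : ℚ} :
    IsLeftOption X (precool G t) ↔ ∃ Y, IsLeftOption Y G ∧ X = cool Y t - number t := by
  cases G with
  | mk m n L R =>
    constructor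
    · rintro ⟨i, rfl⟩
      exact ⟨L i, ⟨i, rfl⟩, rfl⟩
    · rintro ⟨_, ⟨i, rfl⟩, rfl⟩
      exact ⟨i, rfl⟩

theorem isRightOption_precool {G X : ShortGame} {t : ℚ} :
    IsRightOption X (precool G t) ↔ ∃ Y, IsRightOption Y G ∧ X = cool Y t + number t := by
  cases G with
  | mk m n L R =>
    constructor
    · rintro ⟨i, rfl⟩
      exact ⟨R i, ⟨i, rfl⟩, rfl⟩
    · rintro ⟨_, ⟨i, rfl⟩, rfl⟩
      exact ⟨i, rfl⟩

theorem rightStop_sub_number_self (G : ShortGame) {t : ℚ} (ht : IsDyadic t) :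
    rightStop (G - number t) = rightStop G - t := by
  have h : toValue (G - number t) = toValue G + numberValue (-t) := by
    rw [toValue_sub, numberValue_neg, ← sub_eq_add_neg]
    rfl
  rw [rightStop_add_number ht.neg h]
  push_cast
  ring

theorem leftStop_add_number_self (G : ShortGame) {t : ℚ} (ht : IsDyadic t) :
    leftStop (G + number t) = leftStop G + t := leftStop_add_number ht rfl

/-- `G` has the value of an integer. -/
def IsInteger (G : ShortGame) : Prop := ∃ n : ℤ, toValue G = numberValue n

theorem stops_cool_of_eq_int {G : ShortGame} {n : ℤ} (h : toValue G = numberValue n) (t : ℚ) :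
    leftStop (cool G t) = n ∧ rightStop (cool G t) = n := by
  have hex : ∃ a : ℤ, Equal G (ofInt a) := ⟨n, equal_ofInt_iff.2 h⟩
  have hval : toValue (cool G t) = numberValue n := by
    rw [cool_eq_coolStep, coolStep, dif_pos hex, ← h]
    exact (equal_iff.1 hex.choose_spec).symm
  have := stops_of_eq (isDyadic_intCast n) hval
  push_cast at this
  exact this

theorem InfCloseNumber.unique {G : ShortGame} {x y : ℚ} (hx : InfCloseNumber G x)
    (hy : InfCloseNumber G y) : x = y := by
  have h := (infCloseNumber_iff.1 hx).2.1.symm.trans (infCloseNumber_iff.1 hy).2.1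
  exact_mod_cast h

theorem cool_eq_number {G : ShortGame} (hG : ¬ IsInteger G) {s y t : ℚ}
    (hs : IsLeast (closeSet (precool G)) s) (hy : InfCloseNumber (precool G s) y) (hst : s < t) :
    cool G t = number y := by
  have hint : ¬ ∃ a : ℤ, Equal G (ofInt a) := fun ⟨a, ha⟩ => hG ⟨a, equal_ofInt_iff.1 ha⟩
  have hex : ∃ x : ℚ, ∃ s : ℚ, s < t ∧ IsLeast (closeSet (precool G)) s ∧
      InfCloseNumber (precool G s) x := ⟨y, s, hst, hs, hy⟩
  rw [cool_eq_coolStep, coolStep, dif_neg hint, dif_pos hex]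
  obtain ⟨s', -, hs', hx⟩ := hex.choose_spec
  obtain rfl := hs.unique hs'
  rw [hx.unique hy]

theorem cool_eq_precool {G : ShortGame} (hG : ¬ IsInteger G) {t : ℚ}
    (h : ∀ s, IsLeast (closeSet (precool G)) s → t ≤ s) : cool G t = precool G t := by
  have hint : ¬ ∃ a : ℤ, Equal G (ofInt a) := fun ⟨a, ha⟩ => hG ⟨a, equal_ofInt_iff.1 ha⟩
  have hex : ¬ ∃ x : ℚ, ∃ s : ℚ, s < t ∧ IsLeast (closeSet (precool G)) s ∧
      InfCloseNumber (precool G s) x := fun ⟨_, s, hst, hs, _⟩ => (h s hs).not_gt hst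
  rw [cool_eq_coolStep, coolStep, dif_neg hint, dif_neg hex]

theorem exists_isLeftOption_precool {G : ShortGame} (hG : ¬ IsInteger G) (t : ℚ) :
    ∃ X, IsLeftOption X (precool G t) :=
  let ⟨_, hX⟩ := exists_isLeftOption_of_ne_int hG
  ⟨_, isLeftOption_precool.2 ⟨_, hX, rfl⟩⟩

theorem exists_isRightOption_precool {G : ShortGame} (hG : ¬ IsInteger G) (t : ℚ) :
    ∃ X, IsRightOption X (precool G t) :=
  let ⟨_, hX⟩ := exists_isRightOption_of_ne_int hG
  ⟨_, isRightOption_precool.2 ⟨_, hX, rfl⟩⟩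

/-- The left scaffold of `G` at `t`. -/
noncomputable def leftScaffoldAt (G : ShortGame) (t : ℚ) : ℝ := leftScaffold (precool G t)

/-- The right scaffold of `G` at `t`. -/
noncomputable def rightScaffoldAt (G : ShortGame) (t : ℚ) : ℝ := rightScaffold (precool G t)

theorem le_leftScaffoldAt {G X : ShortGame} (h : IsLeftOption X G) {t : ℚ} (ht : IsDyadic t) :
    rightStop (cool X t) - t ≤ leftScaffoldAt G t := by
  rw [← rightStop_sub_number_self _ ht]
  exact le_leftScaffold (isLeftOption_precool.2 ⟨X, h, rfl⟩)

theorem rightScaffoldAt_le {G X : ShortGame} (h : IsRightOption X G) {t : ℚ} (ht : IsDyadic t) :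
    rightScaffoldAt G t ≤ leftStop (cool X t) + t := by
  rw [← leftStop_add_number_self _ ht]
  exact rightScaffold_le (isRightOption_precool.2 ⟨X, h, rfl⟩)

theorem exists_eq_leftScaffoldAt {G : ShortGame} (hG : ¬ IsInteger G) {t : ℚ} (ht : IsDyadic t) :
    ∃ X, IsLeftOption X G ∧ leftScaffoldAt G t = rightStop (cool X t) - t := by
  obtain ⟨_, hX, h⟩ := exists_eq_leftScaffold (exists_isLeftOption_precool hG t)
  obtain ⟨Y, hY, rfl⟩ := isLeftOption_precool.1 hX
  exact ⟨Y, hY, by rw [← rightStop_sub_number_self _ ht, h]; rfl⟩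

theorem exists_eq_rightScaffoldAt {G : ShortGame} (hG : ¬ IsInteger G) {t : ℚ} (ht : IsDyadic t) :
    ∃ X, IsRightOption X G ∧ rightScaffoldAt G t = leftStop (cool X t) + t := by
  obtain ⟨_, hX, h⟩ := exists_eq_rightScaffold (exists_isRightOption_precool hG t)
  obtain ⟨Y, hY, rfl⟩ := isRightOption_precool.1 hX
  exact ⟨Y, hY, by rw [← leftStop_add_number_self _ ht, h]; rfl⟩

theorem mem_closeSet_precool {G : ShortGame} (hG : ¬ IsInteger G) (t : ℚ) :
    t ∈ closeSet (precool G) ↔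
      IsDyadic t ∧ -1 ≤ t ∧ leftScaffoldAt G t + -rightScaffoldAt G t ≤ 0 := by
  refine and_congr_right fun _ => and_congr_right fun _ => ?_
  rw [exists_infCloseNumber_iff (exists_isLeftOption_precool hG t)
    (exists_isRightOption_precool hG t), ← sub_eq_add_neg, sub_nonpos]
  rfl

/-- Each scaffold is a finite extremum of taxed walls of options. The right one is negated so that
both sides become maxima of nonincreasing functions. -/
theorem wall_scaffolds_of_options {G : ShortGame} (hG : ¬ IsInteger G)
    (hL : ∀ X, IsLeftOption X G → Wall fun t => -rightStop (cool X t))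
    (hR : ∀ X, IsRightOption X G → Wall fun t => leftStop (cool X t)) :
    Wall (leftScaffoldAt G) ∧ Wall fun t => -rightScaffoldAt G t := by
  obtain ⟨_, hX⟩ := exists_isLeftOption_of_ne_int hG
  obtain ⟨_, hY⟩ := exists_isRightOption_of_ne_int hG
  cases G with
  | mk m n L R =>
    have : Nonempty (Fin m) := ⟨hX.choose⟩
    have : Nonempty (Fin n) := ⟨hY.choose⟩
    constructor
    · refine Wall.max (g := fun i t => rightStop (cool (L i) t - number t)) (fun i => ?_)
        (fun i t => ?_) (fun t => ?_)
      · refine (hL (L i) ⟨i, rfl⟩).flip.congr fun t ht _ => ?_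
        rw [rightStop_sub_number_self _ ht, neg_neg]
      · exact le_leftScaffold ⟨i, rfl⟩
      · exact exists_eq_ciSup_of_finite (f := fun i => rightStop (cool (L i) t - number t))
    · refine Wall.max (g := fun i t => -leftStop (cool (R i) t + number t)) (fun i => ?_)
        (fun i t => ?_) (fun t => ?_)
      · refine (hR (R i) ⟨i, rfl⟩).flip.congr fun t ht _ => ?_
        rw [leftStop_add_number_self _ ht, neg_add']
      · exact neg_le_neg (rightScaffold_le ⟨i, rfl⟩)
      · obtain ⟨i, hi⟩ :=
          exists_eq_ciInf_of_finite (f := fun i => leftStop (cool (R i) t + number t))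
        exact ⟨i, congrArg Neg.neg hi⟩

/-- The stops of `G_t` for all `t`: the thermograph of `G` follows the scaffolds up to some
temperature `s`, and consists of a vertical mast at `y` from there on, unless the scaffolds never
meet. -/
theorem stops_cool_cases_of_wall {G : ShortGame} (hG : ¬ IsInteger G)
    (hl : Wall (leftScaffoldAt G)) (hr : Wall fun t => -rightScaffoldAt G t) :
    (∀ t, IsDyadic t → -1 ≤ t → rightScaffoldAt G t < leftScaffoldAt G t ∧
      leftStop (cool G t) = leftScaffoldAt G t ∧ rightStop (cool G t) = rightScaffoldAt G t) ∨
    ∃ s y : ℚ, IsDyadic s ∧ IsDyadic y ∧ -1 ≤ s ∧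
      leftScaffoldAt G s ≤ y ∧ y ≤ rightScaffoldAt G s ∧
      (-1 < s → leftScaffoldAt G s = y ∧ rightScaffoldAt G s = y) ∧
      (∀ t, IsDyadic t → -1 ≤ t → t < s → rightScaffoldAt G t < leftScaffoldAt G t ∧
        leftStop (cool G t) = leftScaffoldAt G t ∧ rightStop (cool G t) = rightScaffoldAt G t) ∧
      ∀ t, IsDyadic t → s ≤ t → leftStop (cool G t) = y ∧ rightStop (cool G t) = y := by
  have hfree : ∀ t, IsDyadic t → -1 ≤ t → t ∉ closeSet (precool G) →
      (∀ s, IsLeast (closeSet (precool G)) s → t ≤ s) →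
      rightScaffoldAt G t < leftScaffoldAt G t ∧ leftStop (cool G t) = leftScaffoldAt G t ∧
        rightStop (cool G t) = rightScaffoldAt G t := by
    intro t ht h1 hmem hleast
    have hlt : rightScaffoldAt G t < leftScaffoldAt G t := by
      by_contra! h
      exact hmem ((mem_closeSet_precool hG t).2 ⟨ht, h1, by linarith⟩)
    refine ⟨hlt, ?_⟩
    rw [cool_eq_precool hG hleast]
    exact stops_of_scaffold_lt (exists_isLeftOption_precool hG t)
      (exists_isRightOption_precool hG t) hlt
  rcases (closeSet (precool G)).eq_empty_or_nonempty with hC | hC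
  · left
    intro t ht h1
    refine hfree t ht h1 ?_ fun s hs => ?_
    · rw [hC]
      exact Set.notMem_empty t
    · have := hs.1
      rw [hC] at this
      exact absurd this (Set.notMem_empty s)
  · right
    obtain ⟨s, hs⟩ := Wall.exists_isLeast hl hr (mem_closeSet_precool hG) hC
    obtain ⟨hsd, hs1, y, hy⟩ := hs.1
    obtain ⟨hyd, hy1, hy2⟩ := infCloseNumber_iff.1 hy
    have hsc := hy.scaffolds (exists_isLeftOption_precool hG s) (exists_isRightOption_precool hG s)
    refine ⟨s, y, hsd, hyd, hs1, hsc.1, hsc.2, fun h1 => ?_, fun t ht h1 hts => ?_,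
      fun t ht hst => ?_⟩
    · have h0 := Wall.add_eq_zero_of_isLeast hl hr (mem_closeSet_precool hG) hs h1
      have ha : leftScaffoldAt G s ≤ y := hsc.1
      have hb : y ≤ rightScaffoldAt G s := hsc.2
      constructor <;> linarith
    · refine hfree t ht h1 (fun hmem => (hs.2 hmem).not_gt hts) fun s' hs' => ?_
      rw [hs'.unique hs]
      exact hts.le
    · rcases hst.eq_or_lt with rfl | hlt
      -- At `t = s` the game is not yet replaced by a number: the definition asks for a strictly
      -- smaller index.
      · rw [cool_eq_precool hG fun s' hs' => (hs'.unique hs).ge]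
        exact ⟨hy1, hy2⟩
      · rw [cool_eq_number hG hs hy hlt]
        exact stops_of_eq hyd rfl

/-- The walls of the options give the scaffolds, and the stops of `G_t` are these scaffolds,
possibly truncated at a mast. -/
theorem wall_stops (G : ShortGame) :
    (Wall fun t => leftStop (cool G t)) ∧ Wall fun t => -rightStop (cool G t) := by
  induction G using option_induction with
  | _ G ihL ihR =>
    by_cases hG : IsInteger G
    · obtain ⟨n, hn⟩ := hG
      have h := stops_cool_of_eq_int hn
      refine ⟨(Wall.const (isDyadic_intCast n)).congr fun t _ _ => ?_,
        (Wall.const (isDyadic_intCast n).neg).congr fun t _ _ => ?_⟩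
      · rw [(h t).1]
        push_cast
        rfl
      · rw [(h t).2]
        push_cast
        rfl
    · obtain ⟨hl, hr⟩ := wall_scaffolds_of_options hG (fun X hX => (ihL X hX).2)
        fun X hX => (ihR X hX).1
      rcases stops_cool_cases_of_wall hG hl hr with h | ⟨s, y, hs, hy, -, -, -, hsy, hlt, hge⟩
      · exact ⟨hl.congr fun t ht h1 => (h t ht h1).2.1,
          hr.congr fun t ht h1 => congrArg Neg.neg (h t ht h1).2.2⟩
      · refine ⟨hl.truncate hs hy (fun h => (hsy h).1) (fun t ht h1 hts => (hlt t ht h1 hts).2.1)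
          fun t ht hst => (hge t ht hst).1, hr.truncate hs hy.neg (fun h => ?_)
          (fun t ht h1 hts => congrArg Neg.neg (hlt t ht h1 hts).2.2) fun t ht hst => ?_⟩
        · rw [(hsy h).2]
          push_cast
          rfl
        · rw [(hge t ht hst).2]
          push_cast
          rfl

theorem wall_scaffolds {G : ShortGame} (hG : ¬ IsInteger G) :
    Wall (leftScaffoldAt G) ∧ Wall fun t => -rightScaffoldAt G t :=
  wall_scaffolds_of_options hG (fun X _ => (wall_stops X).2) fun X _ => (wall_stops X).1

theorem stops_cool_cases {G : ShortGame} (hG : ¬ IsInteger G) :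
    (∀ t, IsDyadic t → -1 ≤ t → rightScaffoldAt G t < leftScaffoldAt G t ∧
      leftStop (cool G t) = leftScaffoldAt G t ∧ rightStop (cool G t) = rightScaffoldAt G t) ∨
    ∃ s y : ℚ, IsDyadic s ∧ IsDyadic y ∧ -1 ≤ s ∧
      leftScaffoldAt G s ≤ y ∧ y ≤ rightScaffoldAt G s ∧
      (-1 < s → leftScaffoldAt G s = y ∧ rightScaffoldAt G s = y) ∧
      (∀ t, IsDyadic t → -1 ≤ t → t < s → rightScaffoldAt G t < leftScaffoldAt G t ∧
        leftStop (cool G t) = leftScaffoldAt G t ∧ rightStop (cool G t) = rightScaffoldAt G t) ∧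
      ∀ t, IsDyadic t → s ≤ t → leftStop (cool G t) = y ∧ rightStop (cool G t) = y :=
  stops_cool_cases_of_wall hG (wall_scaffolds hG).1 (wall_scaffolds hG).2

/-! ### Cooling by a negative amount -/

-- Stops of a cooled game and its scaffolds

section Stops

variable {G : ShortGame} {t : ℚ}

theorem leftScaffoldAt_le_leftStop_cool (hG : ¬ IsInteger G) (ht : IsDyadic t) (h1 : -1 ≤ t) :
    leftScaffoldAt G t ≤ leftStop (cool G t) := by
  rcases stops_cool_cases hG with h | ⟨s, y, hs, -, hs1, hly, -, -, hlt, hge⟩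
  · exact (h t ht h1).2.1.ge
  · rcases lt_or_ge t s with hts | hst
    · exact (hlt t ht h1 hts).2.1.ge
    · rw [(hge t ht hst).1]
      exact ((wall_scaffolds hG).1.anti hs ht hs1 hst).trans hly

theorem rightStop_cool_le_rightScaffoldAt (hG : ¬ IsInteger G) (ht : IsDyadic t) (h1 : -1 ≤ t) :
    rightStop (cool G t) ≤ rightScaffoldAt G t := by
  rcases stops_cool_cases hG with h | ⟨s, y, hs, -, hs1, -, hyr, -, hlt, hge⟩
  · exact (h t ht h1).2.2.le
  · rcases lt_or_ge t s with hts | hst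
    · exact (hlt t ht h1 hts).2.2.le
    · rw [(hge t ht hst).2]
      exact hyr.trans (neg_le_neg_iff.1 ((wall_scaffolds hG).2.anti hs ht hs1 hst))

/-- Below the mast the Right stop is the right scaffold; on the mast it is at least the left
scaffold, which has fallen to the mast value or lower. -/
theorem le_rightStop_cool (hG : ¬ IsInteger G) (ht : IsDyadic t) (h1 : -1 ≤ t) {v : ℝ}
    (hl : v ≤ leftScaffoldAt G t) (hr : v ≤ rightScaffoldAt G t) : v ≤ rightStop (cool G t) := by
  rcases stops_cool_cases hG with h | ⟨s, y, hs, -, hs1, hly, -, -, hlt, hge⟩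
  · rwa [(h t ht h1).2.2]
  · rcases lt_or_ge t s with hts | hst
    · rwa [(hlt t ht h1 hts).2.2]
    · rw [(hge t ht hst).2]
      exact hl.trans (((wall_scaffolds hG).1.anti hs ht hs1 hst).trans hly)

theorem leftStop_cool_le (hG : ¬ IsInteger G) (ht : IsDyadic t) (h1 : -1 ≤ t) {v : ℝ}
    (hl : leftScaffoldAt G t ≤ v) (hr : rightScaffoldAt G t ≤ v) : leftStop (cool G t) ≤ v := by
  rcases stops_cool_cases hG with h | ⟨s, y, hs, -, hs1, -, hyr, -, hlt, hge⟩
  · rwa [(h t ht h1).2.1]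
  · rcases lt_or_ge t s with hts | hst
    · rwa [(hlt t ht h1 hts).2.1]
    · rw [(hge t ht hst).1]
      exact (hyr.trans (neg_le_neg_iff.1 ((wall_scaffolds hG).2.anti hs ht hs1 hst))).trans hr

/-- Once the scaffolds meet in `x`, the thermograph is the vertical mast at `x`. -/
theorem stops_cool_of_scaffolds_eq (hG : ¬ IsInteger G) {r : ℚ} (hr : IsDyadic r) (h1 : -1 ≤ r)
    {x : ℝ} (hl : leftScaffoldAt G r = x) (hr' : rightScaffoldAt G r = x) (ht : IsDyadic t)
    (hrt : r ≤ t) : leftStop (cool G t) = x ∧ rightStop (cool G t) = x := by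
  rcases stops_cool_cases hG with h | ⟨s, y, hs, -, hs1, hly, hyr, -, hlt, hge⟩
  · have := (h r hr h1).1
    linarith
  · have hsr : s ≤ r := by
      by_contra! h
      have := (hlt r hr h1 h).1
      linarith
    have ha := (wall_scaffolds hG).1.anti hs hr hs1 hsr
    have hb := (wall_scaffolds hG).2.anti hs hr hs1 hsr
    have hyx : (y : ℝ) = x := by
      apply le_antisymm <;> linarith
    rw [← hyx]
    exact hge t ht (hsr.trans hrt)

end Stops

/-- If `G ≤ u` fails because of a Right option `z` of the number `u` with `z ≤ G`, then `w ≤ z ≤ G`.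
-/
theorem exists_left_of_not_le {G : ShortGame} {u w : ℚ} (hu : IsDyadic u) (hw : IsDyadic w)
    (h : ¬ toValue G ≤ numberValue u)
    (huw : ∀ z, (∀ l, OnGrid l u → u + 1 / 2 ^ l ≤ z) → w ≤ z) :
    (∃ X, IsLeftOption X G ∧ numberValue u ≤ toValue X) ∨ numberValue w ≤ toValue G := by
  rcases not_le_iff_options.1 (mt toValue_le.2 h) with ⟨X, hX, hX'⟩ | ⟨X, hX, hX'⟩
  · exact Or.inl ⟨X, hX, toValue_le.2 hX'⟩
  · obtain ⟨z, hz, rfl, hz', -⟩ := isRightOption_number hu hX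
    exact Or.inr (((numberValue_le hw hz).2 (huw z hz')).trans (toValue_le.2 hX'))

theorem exists_right_of_not_le {G : ShortGame} {u w : ℚ} (hu : IsDyadic u) (hw : IsDyadic w)
    (h : ¬ numberValue u ≤ toValue G)
    (huw : ∀ z, (∀ l, OnGrid l u → z ≤ u - 1 / 2 ^ l) → z ≤ w) :
    (∃ X, IsRightOption X G ∧ toValue X ≤ numberValue u) ∨ toValue G ≤ numberValue w := by
  rcases not_le_iff_options.1 (mt toValue_le.2 h) with ⟨X, hX, hX'⟩ | ⟨X, hX, hX'⟩
  · obtain ⟨z, hz, rfl, hz', -⟩ := isLeftOption_number hu hX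
    exact Or.inr ((toValue_le.2 hX').trans ((numberValue_le hz hw).2 (huw z hz')))
  · exact Or.inl ⟨X, hX, toValue_le.2 hX'⟩

/-- Comparisons of `G` with the multiples of `1 / 2 ^ k` bound the stops of `G` cooled by
`-1 / 2 ^ k`. -/
structure GridBounds (G : ShortGame) (k : ℕ) (u : ℚ) : Prop where
  le_rightStop : numberValue u ≤ toValue G → u ≤ rightStop (cool G (-(1 / 2 ^ k)))
  add_le_leftStop : ¬ toValue G ≤ numberValue u → u + 1 / 2 ^ k ≤ leftStop (cool G (-(1 / 2 ^ k)))
  leftStop_le : toValue G ≤ numberValue u → leftStop (cool G (-(1 / 2 ^ k))) ≤ u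
  rightStop_le : ¬ numberValue u ≤ toValue G → rightStop (cool G (-(1 / 2 ^ k))) ≤ u - 1 / 2 ^ k

theorem neg_one_le_neg_grid (k : ℕ) : -1 ≤ -((1 : ℚ) / 2 ^ k) := by
  rw [neg_le_neg_iff, div_le_one (by positivity)]
  exact one_le_pow₀ (by norm_num)

theorem isDyadic_neg_grid (k : ℕ) : IsDyadic (-(1 / 2 ^ k)) := (onGrid_one_div k).isDyadic.neg

theorem gridBounds_of_stops_eq {G : ShortGame} {k : ℕ} {x u : ℚ} (hx : OnGrid k x)
    (hu : OnGrid k u) (hGx : toValue G = numberValue x)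
    (h : leftStop (cool G (-(1 / 2 ^ k))) = x ∧ rightStop (cool G (-(1 / 2 ^ k))) = x) :
    GridBounds G k u where
  le_rightStop h' := by
    rw [hGx, numberValue_le hu.isDyadic hx.isDyadic] at h'
    rw [h.2]
    exact_mod_cast h'
  add_le_leftStop h' := by
    rw [hGx, numberValue_le hx.isDyadic hu.isDyadic, not_le] at h'
    rw [h.1]
    have h2 := (Rat.cast_le (K := ℝ)).2 (hu.add_le_of_lt hx h')
    push_cast at h2
    exact h2
  leftStop_le h' := by
    rw [hGx, numberValue_le hx.isDyadic hu.isDyadic] at h'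
    rw [h.1]
    exact_mod_cast h'
  rightStop_le h' := by
    rw [hGx, numberValue_le hu.isDyadic hx.isDyadic, not_le] at h'
    rw [h.2, le_sub_iff_add_le]
    have h2 := (Rat.cast_le (K := ℝ)).2 (hx.add_le_of_lt hu h')
    push_cast at h2
    exact h2

/-- The thermograph of a number `x` that is not an integer: its mast starts at `-1 / 2 ^ k`, where
`2 ^ k` is the denominator of `x`, or below. -/
theorem stops_cool_of_eq_number_of_options {G : ShortGame} (hG : ¬ IsInteger G) {x : ℚ}
    (hx : IsDyadic x) (hGx : toValue G = numberValue x)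
    (hL : ∀ X, IsLeftOption X G → ∀ k u, OnGrid k u → GridBounds X k u)
    (hR : ∀ X, IsRightOption X G → ∀ k u, OnGrid k u → GridBounds X k u) :
    ∃ k, OnGrid k x ∧ (∀ l, OnGrid l x → k ≤ l) ∧ ∀ t, IsDyadic t → -(1 / 2 ^ k) ≤ t →
      leftStop (cool G t) = x ∧ rightStop (cool G t) = x := by
  rcases hx.cases with ⟨n, rfl⟩ | ⟨k, a, ha, hxa, hk⟩
  · exact absurd ⟨n, hGx⟩ hG
  have hgrid : OnGrid (k + 1) x := ⟨a, hxa⟩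
  refine ⟨k + 1, hgrid, hk, ?_⟩
  have hc := onGrid_one_div (k + 1)
  have hcpos : (0 : ℚ) < 1 / 2 ^ (k + 1) := by positivity
  have h2c : (1 : ℚ) / 2 ^ k = 2 * (1 / 2 ^ (k + 1)) := by
    rw [pow_succ]
    field_simp
  -- The neighbours `x ± 1 / 2 ^ (k + 1)` lie on the coarser grid, so Right options of the lower one
  -- are at least the upper one, and dually. Hence they cannot explain why `G` fails to be at most
  -- the lower neighbour: a Left option of `G` must.
  have hlo : OnGrid k (x - 1 / 2 ^ (k + 1)) := by
    obtain ⟨b, rfl⟩ : ∃ b, a = 2 * b + 1 := ⟨a / 2, by omega⟩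
    refine ⟨b, ?_⟩
    rw [hxa, pow_succ]
    push_cast
    field_simp
    ring
  have hhi : OnGrid k (x + 1 / 2 ^ (k + 1)) := by
    obtain ⟨b, rfl⟩ : ∃ b, a = 2 * b + 1 := ⟨a / 2, by omega⟩
    refine ⟨b + 1, ?_⟩
    rw [hxa, pow_succ]
    push_cast
    field_simp
    ring
  have hd := isDyadic_neg_grid (k + 1)
  have h1 := neg_one_le_neg_grid (k + 1)
  -- The tax is negative and pays the mover one grid step. Left options are not at least `x`, so
  -- their Right stops are at most one step below `x`, and the payment brings them at most to `x`;
  -- some Left option attains it.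
  have hleft : leftScaffoldAt G (-(1 / 2 ^ (k + 1))) = x := by
    apply le_antisymm
    · obtain ⟨X, hX, h⟩ := exists_eq_leftScaffoldAt hG hd
      rw [h]
      have := (hL X hX (k + 1) x hgrid).rightStop_le
        (by rw [← hGx, toValue_le]; exact not_le_left hX)
      push_cast
      linarith
    · rcases exists_left_of_not_le (G := G) (w := x + 1 / 2 ^ (k + 1)) hlo.isDyadic hhi.isDyadic
        (by rw [hGx, numberValue_le hx hlo.isDyadic, not_le]; linarith)
        (fun z hz => by linarith [hz k hlo]) with ⟨X, hX, h⟩ | h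
      · have h2 := (hL X hX (k + 1) _ (hgrid.sub hc)).le_rightStop h
        have h3 := le_leftScaffoldAt hX hd
        push_cast at h2 h3
        linarith
      · rw [hGx, numberValue_le hhi.isDyadic hx] at h
        linarith
  have hright : rightScaffoldAt G (-(1 / 2 ^ (k + 1))) = x := by
    apply le_antisymm
    · rcases exists_right_of_not_le (G := G) (w := x - 1 / 2 ^ (k + 1)) hhi.isDyadic hlo.isDyadic
        (by rw [hGx, numberValue_le hhi.isDyadic hx, not_le]; linarith)
        (fun z hz => by linarith [hz k hhi]) with ⟨X, hX, h⟩ | h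
      · have h2 := (hR X hX (k + 1) _ (hgrid.add hc)).leftStop_le h
        have h3 := rightScaffoldAt_le hX hd
        push_cast at h2 h3
        linarith
      · rw [hGx, numberValue_le hx hlo.isDyadic] at h
        linarith
    · obtain ⟨X, hX, h⟩ := exists_eq_rightScaffoldAt hG hd
      rw [h]
      have := (hR X hX (k + 1) x hgrid).add_le_leftStop
        (by rw [← hGx, toValue_le]; exact not_le_right hX)
      push_cast
      linarith
  exact fun t ht htk => stops_cool_of_scaffolds_eq hG hd h1 hleft hright ht htk

theorem exists_natCast_mul_gt (k : ℕ) (v : ℚ) : ∃ n : ℕ, v < n * (1 / 2 ^ k) := by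
  obtain ⟨n, hn⟩ := exists_nat_gt (v * 2 ^ k)
  refine ⟨n, ?_⟩
  rw [mul_one_div, lt_div_iff₀ (by positivity)]
  exact hn

/-- The negative tax `-1 / 2 ^ k` exactly offsets the grid step gained from a strict comparison,
which makes the four bounds inductive. Games equal to a number of the grid are already frozen at
this temperature; for the others, comparisons are pushed from one grid point to the next until the
scaffold provides the bound. -/
theorem gridBounds (G : ShortGame) (k : ℕ) (u : ℚ) (hu : OnGrid k u) : GridBounds G k u := by
  induction G using option_induction generalizing k u with
  | _ G ihL ihR =>
    by_cases hG : IsInteger G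
    · obtain ⟨n, hn⟩ := hG
      refine gridBounds_of_stops_eq (onGrid_intCast k n) hu hn ?_
      have := stops_cool_of_eq_int hn (-(1 / 2 ^ k))
      push_cast
      exact this
    have hc := onGrid_one_div k
    have hcpos : (0 : ℝ) < 1 / 2 ^ k := by positivity
    have ht := isDyadic_neg_grid k
    have h1 := neg_one_le_neg_grid k
    by_cases hnum : ∃ x, OnGrid k x ∧ toValue G = numberValue x
    · obtain ⟨x, hxk, hGx⟩ := hnum
      obtain ⟨j, hj, hjmin, hst⟩ :=
        stops_cool_of_eq_number_of_options hG hxk.isDyadic hGx ihL ihR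
      refine gridBounds_of_stops_eq hxk hu hGx (hst _ ht ?_)
      rw [neg_le_neg_iff]
      gcongr
      · norm_num
      · exact hjmin k hxk
    push Not at hnum
    -- No Right option of `G` is at most `u`, so its Left stop is at least one step above `u`; the
    -- tax takes that step back.
    have hrho : ∀ u, OnGrid k u → numberValue u ≤ toValue G →
        u ≤ rightScaffoldAt G (-(1 / 2 ^ k)) := by
      intro u hu h
      obtain ⟨X, hX, hXeq⟩ := exists_eq_rightScaffoldAt hG ht
      have := (ihR X hX k u hu).add_le_leftStop fun h' => not_le_right hX (toValue_le.1 (h'.trans h))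
      rw [hXeq]
      push_cast
      linarith
    have hlam : ∀ u, OnGrid k u → toValue G ≤ numberValue u →
        leftScaffoldAt G (-(1 / 2 ^ k)) ≤ u := by
      intro u hu h
      obtain ⟨X, hX, hXeq⟩ := exists_eq_leftScaffoldAt hG ht
      have := (ihL X hX k u hu).rightStop_le fun h' => not_le_left hX (toValue_le.1 (h.trans h'))
      rw [hXeq]
      push_cast
      linarith
    have hstepL : ∀ u, OnGrid k u → ¬ toValue G ≤ numberValue u →
        (u : ℝ) + 1 / 2 ^ k ≤ leftScaffoldAt G (-(1 / 2 ^ k)) ∨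
          numberValue (u + 1 / 2 ^ k) ≤ toValue G := by
      intro u hu h
      rcases exists_left_of_not_le hu.isDyadic (hu.add hc).isDyadic h (fun z hz => hz k hu) with
        ⟨X, hX, hX'⟩ | h
      · left
        have h2 := (ihL X hX k u hu).le_rightStop hX'
        have h3 := le_leftScaffoldAt hX ht
        push_cast at h3
        linarith
      · exact Or.inr h
    have hstepR : ∀ u, OnGrid k u → ¬ numberValue u ≤ toValue G →
        rightScaffoldAt G (-(1 / 2 ^ k)) ≤ u - 1 / 2 ^ k ∨
          toValue G ≤ numberValue (u - 1 / 2 ^ k) := by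
      intro u hu h
      rcases exists_right_of_not_le hu.isDyadic (hu.sub hc).isDyadic h (fun z hz => hz k hu) with
        ⟨X, hX, hX'⟩ | h
      · left
        have h2 := (ihR X hX k u hu).leftStop_le hX'
        have h3 := rightScaffoldAt_le hX ht
        push_cast at h3
        linarith
      · exact Or.inr h
    have hR1 : ∀ u, OnGrid k u → numberValue u ≤ toValue G →
        u ≤ rightStop (cool G (-(1 / 2 ^ k))) := by
      obtain ⟨N, hN⟩ := exists_le_number G
      -- Either the left scaffold already reaches `u + 1 / 2 ^ k`, or `u` may be raised by one step.
      -- The climb ends because `G ≤ N`; `n` counts the steps that carry `u` beyond `N`.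
      have key : ∀ n : ℕ, ∀ u, OnGrid k u → (N : ℚ) < u + n * (1 / 2 ^ k) →
          numberValue u ≤ toValue G → u ≤ rightStop (cool G (-(1 / 2 ^ k))) := by
        intro n
        induction n with
        | zero =>
          intro u hu hlt h
          have := (numberValue_le hu.isDyadic (isDyadic_natCast N)).1 (h.trans (toValue_le.2 hN))
          rw [Nat.cast_zero, zero_mul, add_zero] at hlt
          exact absurd this (not_le.2 hlt)
        | succ n ih =>
          intro u hu hlt h
          have hne := hnum u hu
          rcases hstepL u hu fun h' => hne (le_antisymm h' h) with h' | h'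
          · exact le_rightStop_cool hG ht h1 (by linarith) (hrho u hu h)
          · have := ih (u + 1 / 2 ^ k) (hu.add hc) (by push_cast at hlt; linarith) h'
            push_cast at this
            linarith
      intro u hu h
      obtain ⟨n, hn⟩ := exists_natCast_mul_gt k (N - u)
      exact key n u hu (by linarith) h
    have hL1 : ∀ u, OnGrid k u → toValue G ≤ numberValue u →
        leftStop (cool G (-(1 / 2 ^ k))) ≤ u := by
      obtain ⟨N, hN⟩ := exists_number_le G
      have key : ∀ n : ℕ, ∀ u, OnGrid k u → u - n * (1 / 2 ^ k) < -(N : ℚ) →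
          toValue G ≤ numberValue u → leftStop (cool G (-(1 / 2 ^ k))) ≤ u := by
        intro n
        induction n with
        | zero =>
          intro u hu hlt h
          have := (numberValue_le (isDyadic_natCast N).neg hu.isDyadic).1
            ((toValue_le.2 hN).trans h)
          rw [Nat.cast_zero, zero_mul, sub_zero] at hlt
          exact absurd this (not_le.2 hlt)
        | succ n ih =>
          intro u hu hlt h
          have hne := hnum u hu
          rcases hstepR u hu fun h' => hne (le_antisymm h h') with h' | h'
          · exact leftStop_cool_le hG ht h1 (hlam u hu h) (by linarith)
          · have := ih (u - 1 / 2 ^ k) (hu.sub hc) (by push_cast at hlt; linarith) h'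
            push_cast at this
            linarith
      intro u hu h
      obtain ⟨n, hn⟩ := exists_natCast_mul_gt k (N + u)
      exact key n u hu (by linarith) h
    refine ⟨hR1 u hu, fun h => ?_, hL1 u hu, fun h => ?_⟩
    · rcases hstepL u hu h with h' | h'
      · exact h'.trans (leftScaffoldAt_le_leftStop_cool hG ht h1)
      · have := (hR1 _ (hu.add hc) h').trans (rightStop_le_leftStop _)
        push_cast at this
        exact this
    · rcases hstepR u hu h with h' | h'
      · exact (rightStop_cool_le_rightScaffoldAt hG ht h1).trans h'
      · have := (rightStop_le_leftStop _).trans (hL1 _ (hu.sub hc) h')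
        push_cast at this
        exact this

/-! ### Cooling by zero -/

/-- By induction the scaffolds of `G` at `0` are its ordinary scaffolds. What remains is that a mast
starting at or below `0` stands in the right place; for numbers this is the analysis of negative
temperatures. -/
theorem stops_cool_zero (G : ShortGame) :
    leftStop (cool G 0) = leftStop G ∧ rightStop (cool G 0) = rightStop G := by
  induction G using option_induction with
  | _ G ihL ihR =>
    by_cases hG : IsInteger G
    · obtain ⟨n, hn⟩ := hG
      have h := stops_of_eq (isDyadic_intCast n) hn
      push_cast at h
      rw [h.1, h.2]
      exact stops_cool_of_eq_int hn 0
    by_cases hnum : IsNumber G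
    · obtain ⟨x, hx, hGx⟩ := hnum
      obtain ⟨k, -, -, hst⟩ := stops_cool_of_eq_number_of_options hG hx hGx
        (fun X _ => gridBounds X) fun X _ => gridBounds X
      rw [(stops_of_eq hx hGx).1, (stops_of_eq hx hGx).2]
      exact hst 0 isDyadic_zero (neg_nonpos.2 (by positivity))
    have hl : leftScaffoldAt G 0 = leftScaffold G := by
      apply le_antisymm
      · obtain ⟨X, hX, h⟩ := exists_eq_leftScaffoldAt hG isDyadic_zero
        rw [h, (ihL X hX).2, Rat.cast_zero, sub_zero]
        exact le_leftScaffold hX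
      · obtain ⟨X, hX, h⟩ := exists_eq_leftScaffold (exists_isLeftOption_of_ne_int hG)
        have := le_leftScaffoldAt hX isDyadic_zero
        rwa [(ihL X hX).2, Rat.cast_zero, sub_zero, h] at this
    have hr : rightScaffoldAt G 0 = rightScaffold G := by
      apply le_antisymm
      · obtain ⟨X, hX, h⟩ := exists_eq_rightScaffold (exists_isRightOption_of_ne_int hG)
        have := rightScaffoldAt_le hX isDyadic_zero
        rwa [(ihR X hX).1, Rat.cast_zero, add_zero, h] at this
      · obtain ⟨X, hX, h⟩ := exists_eq_rightScaffoldAt hG isDyadic_zero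
        rw [h, (ihR X hX).1, Rat.cast_zero, add_zero]
        exact rightScaffold_le hX
    have hle := rightScaffold_le_leftScaffold hnum
    rw [(stops_of_not_isNumber hnum).1, (stops_of_not_isNumber hnum).2, ← hl, ← hr]
    rw [← hl, ← hr] at hle
    have h1 : (-1 : ℚ) ≤ 0 := by norm_num
    -- For a non-number with a mast from `s ≤ 0`, monotonicity puts the left scaffold at `0` below
    -- `y` and the right one above it, while at `0` they are ordered the other way. Both equal `y`.
    rcases stops_cool_cases hG with h | ⟨s, y, hs, -, hs1, hly, hyr, -, hlt, hge⟩
    · exact (h 0 isDyadic_zero h1).2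
    · rcases lt_or_ge 0 s with h0 | h0
      · exact (hlt 0 isDyadic_zero h1 h0).2
      · have ha := (wall_scaffolds hG).1.anti hs isDyadic_zero hs1 h0
        have hb := (wall_scaffolds hG).2.anti hs isDyadic_zero hs1 h0
        rw [(hge 0 isDyadic_zero h0).1, (hge 0 isDyadic_zero h0).2]
        constructor <;> apply le_antisymm <;> linarith

theorem leftStop_cool_le_leftStop (G : ShortGame) {t : ℚ} (ht : IsDyadic t) (h0 : 0 ≤ t) :
    leftStop (cool G t) ≤ leftStop G := by
  rw [← (stops_cool_zero G).1]
  exact (wall_stops G).1.anti isDyadic_zero ht (by norm_num) h0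

theorem rightStop_le_rightStop_cool (G : ShortGame) {t : ℚ} (ht : IsDyadic t) (h0 : 0 ≤ t) :
    rightStop G ≤ rightStop (cool G t) := by
  rw [← (stops_cool_zero G).2]
  exact neg_le_neg_iff.1 ((wall_stops G).2.anti isDyadic_zero ht (by norm_num) h0)

/-! ### Temperatures -/

/-- The core estimate: `G` and its options enter only through their stops, and by `t = K/2 + J` the
scaffolds have met. -/
theorem mem_closeSet_cool {G : ShortGame} {J K : ℝ} (hJ : 0 ≤ J) (hK : 0 ≤ K)
    (hGK : confusionLength G ≤ K)
    (hL : ∀ H, IsLeftOption H G → confusionLength H ≤ J)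
    (hR : ∀ H, IsRightOption H G → confusionLength H ≤ J) {t : ℚ} (ht : IsDyadic t)
    (hKJ : K / 2 + J ≤ t) : t ∈ closeSet (cool G) := by
  have h0' : (0 : ℝ) ≤ t := le_trans (by positivity) hKJ
  have h0 : 0 ≤ t := by exact_mod_cast h0'
  have h1 : -1 ≤ t := by linarith
  by_cases hG : IsInteger G
  · obtain ⟨n, hn⟩ := hG
    refine ⟨ht, h1, n, infCloseNumber_iff.2 ⟨isDyadic_intCast n, ?_⟩⟩
    push_cast
    exact stops_cool_of_eq_int hn t
  -- With `X` and `Y` the optimal options, the left side is at most `LS(G) + J - t` and the right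
  -- side at least `RS(G) - J + t`. One `J` is paid for passing from `LS(X)` to `RS(X)`, the other
  -- for `Y`.
  have hle : leftScaffoldAt G t ≤ rightScaffoldAt G t := by
    obtain ⟨X, hX, hXeq⟩ := exists_eq_leftScaffoldAt hG ht
    obtain ⟨Y, hY, hYeq⟩ := exists_eq_rightScaffoldAt hG ht
    have x1 := (rightStop_le_leftStop _).trans (leftStop_cool_le_leftStop X ht h0)
    have x2 := (le_leftScaffold hX).trans
      (leftScaffold_le_leftStop (exists_isLeftOption_of_ne_int hG))
    have x3 := hL X hX
    have y1 := (rightStop_le_rightStop_cool Y ht h0).trans (rightStop_le_leftStop _)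
    have y2 := (rightStop_le_rightScaffold (exists_isRightOption_of_ne_int hG)).trans
      (rightScaffold_le hY)
    have y3 := hR Y hY
    rw [confusionLength] at hGK x3 y3
    rw [hXeq, hYeq]
    linarith
  rcases stops_cool_cases hG with h | ⟨s, y, -, hy, -, -, -, -, hlt, hge⟩
  · exact absurd hle (h t ht h1).1.not_ge
  · rcases lt_or_ge t s with hts | hst
    · exact absurd hle (hlt t ht h1 hts).1.not_ge
    · exact ⟨ht, h1, y, infCloseNumber_iff.2 ⟨hy, hge t ht hst⟩⟩

theorem temperature_le {G : ShortGame} {t : ℚ} (ht : t ∈ closeSet (cool G)) :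
    temperature G ≤ t := by
  refine csInf_le ⟨-1, ?_⟩ ⟨t, ht, rfl⟩
  rintro _ ⟨s, hs, rfl⟩
  have h := hs.2.1
  change (-1 : ℝ) ≤ (s : ℝ)
  exact_mod_cast h

end ShortGame

theorem mainTheorem2 (S : Set ShortGame) (J K : ℝ) (hJ : 0 ≤ J) (hK : 0 ≤ K)
    (hSK : ∀ G ∈ S, ShortGame.confusionLength G ≤ K)
    (hSL : ∀ G ∈ S, ∀ H : ShortGame, ShortGame.IsLeftOption H G →
      ShortGame.confusionLength H ≤ J)
    (hSR : ∀ G ∈ S, ∀ H : ShortGame, ShortGame.IsRightOption H G →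
      ShortGame.confusionLength H ≤ J) :
    ShortGame.boilingPoint S ≤ ((K / 2 + J : ℝ) : EReal) := by
  refine iSup₂_le fun G hG => EReal.coe_le_coe_iff.2 ?_
  by_contra! hlt
  -- `K / 2 + J` need not be dyadic, so a dyadic `t` strictly between it and the temperature is
  -- used.
  obtain ⟨t, ht, h₁, h₂⟩ := ShortGame.exists_isDyadic_between hlt
  exact h₂.not_ge (ShortGame.temperature_le (ShortGame.mem_closeSet_cool hJ hK (hSK G hG)
    (hSL G hG) (hSR G hG) ht h₁.le))
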